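/- Let $\mathbb{H}$ be the real quaternions. For $A\in \mathrm{M}(n,\mathbb{H})$ write $A=A_1+A_2\mathbf{j}$ with $A_1,A_2\in \mathrm{M}(n,\mathbb{C})$, and put $\det A:=\det\begin{pmatrix}A_1&A_2\\-\overline{A_2}&\overline{A_1}\end{pmatrix}$. Let $\mathrm{GL}(n,\mathbb{H})$ be the group of invertible matrices in $\mathrm{M}(n,\mathbb{H})$ and $\mathrm{SL}(n,\mathbb{H})$ its subgroup of matrices with $\det A=1$. An element $g$ of a group $G$ is reversible in $G$ if $hgh^{-1}=g^{-1}$ for some $h\in G$, and strongly reversible in $G$ if such an $h$ can be chosen with $h^2=1$. For $\lambda\in\mathbb{C}$ and $m\ge 1$ let $\mathrm{J}(\lambda,m)$ be the $m\times m$ Jordan block with $\lambda$ on the diagonal, $1$ on the superdiagonal and $0$ elsewhere. A Jordan decomposition of $A\in\mathrm{M}(n,\mathbb{H})$ is a finite family of Jordan blocks $\mathrm{J}(\lambda_1,m_1),\dots,\mathrm{J}(\lambda_k,m_k)$ with $\lambda_i\in\mathbb{C}$, $\mathrm{Im}\,\lambda_i\ge 0$ and $m_i\ge 1$, such that $SAS^{-1}=\mathrm{J}(\lambda_1,m_1)\oplus\cdots\oplus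 \mathrm{J}(\lambda_k,m_k)$ for some $S\in\mathrm{GL}(n,\mathbb{H})$. **Theorem.** Let $A\in \mathrm{SL}(n,\mathbb{H})$ be reversible in $\mathrm{SL}(n,\mathbb{H})$. Then $A$ has a Jordan decomposition, and for every Jordan decomposition of $A$ the following are equivalent: 1. $A$ is strongly reversible in $\mathrm{SL}(n,\mathbb{H})$; 2. $A$ is strongly reversible in $\mathrm{GL}(n,\mathbb{H})$; 3. for every $\lambda\in\mathbb{C}\setminus\mathbb{R}$ with $|\lambda|=1$ and every $s\ge 1$, the number of indices $i$ with $\mathrm{J}(\lambda_i,m_i)=\mathrm{J}(\lambda,s)$ is even. -/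

import Mathlib

noncomputable section

namespace QuatRev

/-- `g` is reversible in the group `G`: it is conjugate to its inverse in `G`. -/
def Reversible {G : Type*} [Group G] (g : G) : Prop :=
  ∃ h : G, h * g * h⁻¹ = g⁻¹

/-- `g` is strongly reversible in the group `G`: it is conjugate to its inverse by an
involution of `G` (an element of order at most two). -/
def StronglyReversible {G : Type*} [Group G] (g : G) : Prop :=
  ∃ h : G, h * h = 1 ∧ h * g * h⁻¹ = g⁻¹

/-- `M(n, ℍ)`. -/
abbrev MatH (n : ℕ) : Type := Matrix (Fin n) (Fin n) (Quaternion ℝ)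

/-- `GL(n, ℍ)`, the group of invertible `n × n` quaternionic matrices. -/
abbrev GLH (n : ℕ) : Type := (MatH n)ˣ

/-- The first complex coordinate `z` of a quaternion `q = z + w j`. -/
def cpart (q : Quaternion ℝ) : ℂ := ⟨q.re, q.imI⟩

/-- The second complex coordinate `w` of a quaternion `q = z + w j`. -/
def jpart (q : Quaternion ℝ) : ℂ := ⟨q.imJ, q.imK⟩

/-- The embedding of `M(n, ℍ)` into `M(2n, ℂ)` that sends `A₁ + A₂ j` to the block matrix
with rows `(A₁, A₂)` and `(-conj A₂, conj A₁)`. -/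
def toComplex {n : ℕ} (A : MatH n) : Matrix (Fin n ⊕ Fin n) (Fin n ⊕ Fin n) ℂ :=
  Matrix.fromBlocks (A.map cpart) (A.map jpart)
    (-(A.map fun q => (starRingEnd ℂ) (jpart q))) (A.map fun q => (starRingEnd ℂ) (cpart q))

/-- The quaternionic determinant: the determinant of the associated complex matrix. -/
def qdet {n : ℕ} (A : MatH n) : ℂ := (toComplex A).det

theorem cpart_mul (p q : Quaternion ℝ) :
    cpart (p * q) = cpart p * cpart q - jpart p * (starRingEnd ℂ) (jpart q) := by
  apply Complex.ext <;> simp [cpart, jpart] <;> ring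

theorem jpart_mul (p q : Quaternion ℝ) :
    jpart (p * q) = cpart p * jpart q + jpart p * (starRingEnd ℂ) (cpart q) := by
  apply Complex.ext <;> simp [cpart, jpart] <;> ring

theorem cpart_sum {ι : Type*} (s : Finset ι) (f : ι → Quaternion ℝ) :
    cpart (∑ i ∈ s, f i) = ∑ i ∈ s, cpart (f i) :=
  map_sum (AddMonoidHom.mk' cpart fun a b => by apply Complex.ext <;> simp [cpart]) f s

theorem jpart_sum {ι : Type*} (s : Finset ι) (f : ι → Quaternion ℝ) :
    jpart (∑ i ∈ s, f i) = ∑ i ∈ s, jpart (f i) :=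
  map_sum (AddMonoidHom.mk' jpart fun a b => by apply Complex.ext <;> simp [jpart]) f s

theorem toComplex_mul {n : ℕ} (A B : MatH n) :
    toComplex (A * B) = toComplex A * toComplex B := by
  unfold toComplex
  rw [Matrix.fromBlocks_multiply]
  congr 1 <;> ext i j <;>
    simp [Matrix.mul_apply, cpart_sum, jpart_sum, cpart_mul, jpart_mul,
      Finset.sum_add_distrib] <;> ring

theorem toComplex_one {n : ℕ} : toComplex (1 : MatH n) = 1 := by
  have h0 : cpart 0 = 0 := rfl
  have h1 : cpart 1 = 1 := rfl
  have h2 : jpart 0 = 0 := rfl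
  have h3 : jpart 1 = 0 := rfl
  unfold toComplex
  rw [← Matrix.fromBlocks_one]
  congr 1 <;> ext i j <;> by_cases h : i = j <;>
    simp [Matrix.one_apply, h, h0, h1, h2, h3]

theorem qdet_mul {n : ℕ} (A B : MatH n) : qdet (A * B) = qdet A * qdet B := by
  simp [qdet, toComplex_mul]

theorem qdet_one {n : ℕ} : qdet (1 : MatH n) = 1 := by
  simp [qdet, toComplex_one]

/-- `SL(n, ℍ)`, the subgroup of `GL(n, ℍ)` of elements of quaternionic determinant one. -/
def SLH (n : ℕ) : Subgroup (GLH n) where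
  carrier := {g | qdet (g : MatH n) = 1}
  mul_mem' := by
    intro a b ha hb
    change qdet (a : MatH n) = 1 at ha
    change qdet (b : MatH n) = 1 at hb
    change qdet ((a * b : GLH n) : MatH n) = 1
    rw [Units.val_mul, qdet_mul, ha, hb, one_mul]
  one_mem' := qdet_one
  inv_mem' := by
    intro a ha
    change qdet (a : MatH n) = 1 at ha
    change qdet ((a⁻¹ : GLH n) : MatH n) = 1
    have h := qdet_mul (a : MatH n) ((a⁻¹ : GLH n) : MatH n)
    rw [Units.mul_inv, qdet_one, ha, one_mul] at h
    exact h.symm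

/-- The Jordan block `J(c, m)`: `c` on the diagonal, `1` on the superdiagonal, `0` elsewhere. -/
def jordanBlock (c : ℂ) (m : ℕ) : Matrix (Fin m) (Fin m) (Quaternion ℝ) :=
  Matrix.of fun i j =>
    if i = j then (c : Quaternion ℝ) else if (i : ℕ) + 1 = (j : ℕ) then 1 else 0

/-- A finite family of Jordan blocks `J(eig i, size i)`, `i < k`, of positive sizes, whose
eigenvalues are complex numbers with non-negative imaginary part (that is, the chosen
representatives of the similarity classes of quaternions). -/
structure JordanData where
  k : ℕ
  eig : Fin k → ℂ
  size : Fin k → ℕ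
  eig_im_nonneg : ∀ i, 0 ≤ (eig i).im
  size_pos : ∀ i, 0 < size i

/-- The block diagonal matrix `J(eig 0, size 0) ⊕ ⋯ ⊕ J(eig (k-1), size (k-1))`. -/
def JordanData.form (D : JordanData) :
    Matrix (Σ i : Fin D.k, Fin (D.size i)) (Σ i : Fin D.k, Fin (D.size i)) (Quaternion ℝ) :=
  Matrix.blockDiagonal' fun i => jordanBlock (D.eig i) (D.size i)

/-- The number of times the Jordan block `J(c, s)` occurs in the family `D`. -/
def JordanData.multiplicity (D : JordanData) (c : ℂ) (s : ℕ) : ℕ :=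
  Nat.card {i : Fin D.k // D.eig i = c ∧ D.size i = s}

/-- `D` is a Jordan decomposition of `A`: the sizes of the blocks add up to `n`, and
`S A S⁻¹` is the Jordan form of `D`, where `S` is invertible and the rows and columns of the
Jordan form are numbered block after block. -/
def IsJordanDecomposition {n : ℕ} (A : MatH n) (D : JordanData) : Prop :=
  ∃ (h : ∑ i, D.size i = n) (S : GLH n),
    (S : MatH n) * A * ((S⁻¹ : GLH n) : MatH n) =
      Matrix.reindex (finSigmaFinEquiv.trans (finCongr h))
        (finSigmaFinEquiv.trans (finCongr h)) D.form

/-- Every Jordan block of `D` whose eigenvalue is non-real of unit modulus occurs with even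
multiplicity. -/
def JordanData.EvenNonrealUnit (D : JordanData) : Prop :=
  ∀ c : ℂ, c.im ≠ 0 → ‖c‖ = 1 → ∀ s : ℕ, Even (D.multiplicity c s)

end QuatRev

end

noncomputable section

namespace QuatRev

open Module Submodule

/-! Row vectors form a left quaternionic space on which `A` acts as an endomorphism `f`. Over ℂ, `f`
commutes with the antilinear map `j` of square -1, which exchanges the generalized eigenspaces of λ
and its conjugate. This yields Jordan bases (`hasJordanBasis_quaternion`), and the dimensions of
`ker (f - λ)^k` determine how often each block occurs (`multiplicity_mul_eq`), whichever
decomposition is used.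

Evenness is necessary: an `h` with `h f h⁻¹ = f⁻¹` maps `ker (f - λ)^k` into `ker (f - λ⁻¹)^k`. If
|λ| = 1 then λ⁻¹ is the conjugate of λ, so `j h` is an antilinear map of `ker (f - λ)^k` to itself,
and `h² = 1` gives `(j h)² = -1`. Such a space has even complex dimension
(`even_finrank_of_quaternionic_structure`), and for nonreal λ the multiplicities have the parity of
sums of these dimensions.

Evenness is sufficient: reversibility alone makes the blocks of λ and of conj(λ)⁻¹ equally frequent,
size by size. The labels fixed by this symmetry have |λ| = 1; when the nonreal ones have even
multiplicity, the blocks can be paired by an involution fixing only blocks with real eigenvalue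
(`exists_pairing`). Sending the head of each chain to 1, `j` or `-j` times the head of its partner
extends to a reversing involution (`exists_reversing_involution`).

The passage between GL and SL is free: the quaternionic determinant is real and non-negative
(`exists_qdet_eq`), so an involution has determinant 1. -/

/-- `f` has a Jordan basis of the subspace `U`, with eigenvalues in `C`: the `i`-th chain is
`b i 0, …, b i (m i - 1)`. -/
def HasJordanBasis {K V : Type*} [DivisionRing K] [AddCommGroup V] [Module K V]
    (f : V → V) (C : Set K) (U : Submodule K V) : Prop :=
  ∃ (ι : Type) (_ : Fintype ι) (c : ι → K) (m : ι → ℕ) (b : ι → ℕ → V),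
    (∀ i, c i ∈ C) ∧ (∀ i, 0 < m i) ∧ (∀ i j, f (b i j) = c i • b i j + b i (j + 1)) ∧
    (∀ i, b i (m i) = 0) ∧ LinearIndependent K (fun x : Σ i, Fin (m i) => b x.1 x.2) ∧
    span K (Set.range fun x : Σ i, Fin (m i) => b x.1 x.2) = U

/-! ### Jordan bases of nilpotent maps over a division ring -/

section JordanBasis

variable {K V : Type*} [DivisionRing K] [AddCommGroup V] [Module K V]

theorem HasJordanBasis.bot (f : V → V) (C : Set K) : HasJordanBasis f C ⊥ :=
  ⟨PEmpty, inferInstance, fun i => i.elim, fun _ => 0, fun i => i.elim, fun i => i.elim,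
    fun i => i.elim, fun i => i.elim, fun i => i.elim, linearIndependent_empty_type, by
      rw [Set.range_eq_empty, span_empty]⟩

theorem HasJordanBasis.sup {f : V → V} {C : Set K} {U W : Submodule K V}
    (hU : HasJordanBasis f C U) (hW : HasJordanBasis f C W) (h : Disjoint U W) :
    HasJordanBasis f C (U ⊔ W) := by
  obtain ⟨ι, _, c, m, b, hc, hm, hb, hz, hi, hs⟩ := hU
  obtain ⟨ι', _, c', m', b', hc', hm', hb', hz', hi', hs'⟩ := hW
  let e : (Σ i : ι ⊕ ι', Fin (Sum.elim m m' i)) ≃ (Σ i, Fin (m i)) ⊕ (Σ i, Fin (m' i)) :=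
    Equiv.sumSigmaDistrib _
  let F : (Σ i, Fin (m i)) ⊕ (Σ i, Fin (m' i)) → V :=
    Sum.elim (fun x => b x.1 x.2) (fun x => b' x.1 x.2)
  have hF : (fun x : Σ i : ι ⊕ ι', Fin (Sum.elim m m' i) => Sum.elim b b' x.1 x.2) = F ∘ e := by
    ext ⟨i | i, j⟩ <;> rfl
  refine ⟨ι ⊕ ι', inferInstance, Sum.elim c c', Sum.elim m m', Sum.elim b b', ?_, ?_, ?_, ?_, ?_, ?_⟩
  · rintro (i | i); exacts [hc i, hc' i]
  · rintro (i | i); exacts [hm i, hm' i]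
  · rintro (i | i) j; exacts [hb i j, hb' i j]
  · rintro (i | i); exacts [hz i, hz' i]
  · rw [hF, linearIndependent_equiv]
    exact hi.sum_type hi' (by rw [hs, hs']; exact h)
  · rw [hF, Set.range_comp, e.range_eq_univ, Set.image_univ, Set.Sum.elim_range, span_union, hs, hs']

theorem HasJordanBasis.map {V' : Type*} [AddCommGroup V'] [Module K V'] {f : V → V} {C : Set K}
    {U : Submodule K V} (hU : HasJordanBasis f C U) (g : V →ₗ[K] V') (hg : Function.Injective g)
    (f' : V' → V') (hf : ∀ x, f' (g x) = g (f x)) : HasJordanBasis f' C (U.map g) := by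
  obtain ⟨ι, _, c, m, b, hc, hm, hb, hz, hi, hs⟩ := hU
  refine ⟨ι, inferInstance, c, m, fun i j => g (b i j), hc, hm, fun i j => ?_, fun i => ?_, ?_, ?_⟩
  · rw [hf, hb, map_add, map_smul]
  · exact (congrArg g (hz i)).trans (map_zero g)
  · exact hi.map' g (LinearMap.ker_eq_bot.2 hg)
  · rw [← hs, Submodule.map_span, ← Set.range_comp]; rfl

/-- A functional not vanishing at the end of a chain detects the coefficients of the chain. -/
theorem chain_coeff_eq_zero (N : End K V) (φ : V →ₗ[K] K) {m : ℕ} {v : V}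
    (hv : (N ^ m) v = 0) (hφ : φ ((N ^ (m - 1)) v) = 1) (a : Fin m → K)
    (ha : ∀ i, φ ((N ^ i) (∑ j, a j • (N ^ (j : ℕ)) v)) = 0) (j : Fin m) : a j = 0 := by
  obtain ⟨j, hj⟩ := j
  induction j using Nat.strong_induction_on with
  | _ j ih =>
    -- Under `φ ∘ N ^ (m - 1 - j)` the terms below `j` vanish by induction, those above because `N ^
    -- m` kills `v`; what remains is `a j`.
    have h := ha (m - 1 - j)
    simp only [map_sum, map_smul, ← Module.End.mul_apply, ← pow_add] at h
    rw [Finset.sum_eq_single ⟨j, hj⟩] at h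
    · rw [show m - 1 - j + j = m - 1 by omega, hφ, smul_eq_mul, mul_one] at h
      exact h
    · rintro ⟨l, hl⟩ - hlj
      have hlj' : l ≠ j := fun h => hlj (Fin.ext h)
      rcases lt_or_gt_of_ne hlj' with h1 | h1
      · rw [ih l h1 hl, zero_smul]
      · have : (N ^ (m - 1 - j + l)) v = 0 := by
          rw [show m - 1 - j + l = (l - j - 1) + m by omega, pow_add, Module.End.mul_apply, hv,
            map_zero]
        simp only [this, map_zero, smul_zero]
    · simp

/-- The span of a chain has a complement on which all the functionals `φ ∘ N ^ i` vanish. -/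
theorem exists_mem_span_chain (N : End K V) (φ : V →ₗ[K] K) {m : ℕ} {v : V}
    (hv : (N ^ m) v = 0) (hφ : φ ((N ^ (m - 1)) v) = 1) (x : V) (hx : (N ^ m) x = 0) :
    ∃ w ∈ span K (Set.range fun j : Fin m => (N ^ (j : ℕ)) v), ∀ i, φ ((N ^ i) (x - w)) = 0 := by
  -- The functionals are cleared from the top index down: a multiple of `N ^ k v` corrects index `m
  -- - 1 - k` and does not affect higher ones.
  suffices H : ∀ k ≤ m, ∃ w ∈ span K (Set.range fun j : Fin m => (N ^ (j : ℕ)) v),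
      ∀ i, m ≤ i + k → φ ((N ^ i) (x - w)) = 0 by
    obtain ⟨w, hw, h⟩ := H m le_rfl
    exact ⟨w, hw, fun i => h i (by omega)⟩
  intro k
  induction k with
  | zero =>
    refine fun _ => ⟨0, zero_mem _, fun i hi => ?_⟩
    rw [sub_zero, show i = (i - m) + m by omega, pow_add, Module.End.mul_apply, hx, map_zero,
      map_zero]
  | succ k ih =>
    intro hk
    obtain ⟨w, hw, h⟩ := ih (by omega)
    refine ⟨w + φ ((N ^ (m - 1 - k)) (x - w)) • (N ^ k) v,
      add_mem hw (smul_mem _ _ (subset_span ⟨⟨k, hk⟩, rfl⟩)), fun i hi => ?_⟩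
    rw [← sub_sub, map_sub, map_sub, map_smul, map_smul, ← Module.End.mul_apply (N ^ i) (N ^ k),
      ← pow_add]
    rcases Nat.lt_or_ge (i + k) m with h1 | h1
    · rw [show i + k = m - 1 by omega, hφ, show i = m - 1 - k by omega, smul_eq_mul, mul_one,
        sub_self]
    · rw [h i h1, show i + k = (i + k - m) + m by omega, pow_add, Module.End.mul_apply, hv, map_zero,
        map_zero, smul_zero, sub_zero]

theorem exists_functional_eq_one {u : V} (hu : u ≠ 0) : ∃ φ : V →ₗ[K] K, φ u = 1 := by
  obtain ⟨φ, h⟩ := (LinearMap.toSpanSingleton K V u).exists_leftInverse_of_injective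
    (LinearMap.ker_toSpanSingleton K hu)
  exact ⟨φ, by simpa using LinearMap.congr_fun h 1⟩

theorem hasJordanBasis_span_chain (N : End K V) {m : ℕ} (hm : 0 < m) {v : V} (hv : (N ^ m) v = 0)
    (hi : LinearIndependent K fun j : Fin m => (N ^ (j : ℕ)) v) :
    HasJordanBasis N {(0 : K)} (span K (Set.range fun j : Fin m => (N ^ (j : ℕ)) v)) := by
  let e : (Σ _ : Unit, Fin m) ≃ Fin m := Equiv.uniqueSigma _
  have hF : (fun x : Σ _ : Unit, Fin m => (N ^ (x.2 : ℕ)) v) =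
      (fun j : Fin m => (N ^ (j : ℕ)) v) ∘ e := rfl
  refine ⟨Unit, inferInstance, fun _ => 0, fun _ => m, fun _ j => (N ^ j) v, fun _ => rfl,
    fun _ => hm, fun _ j => ?_, fun _ => hv, ?_, ?_⟩
  · simp only [zero_smul, zero_add, pow_succ', Module.End.mul_apply]
  · rw [hF, linearIndependent_equiv]; exact hi
  · rw [hF, Set.range_comp, e.range_eq_univ, Set.image_univ]

/-- A nilpotent endomorphism of a finite-dimensional space over a division ring has a Jordan
basis. -/
theorem hasJordanBasis_of_nilpotent (N : End K V) (U : Submodule K V) [FiniteDimensional K U]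
    (hNU : ∀ x ∈ U, N x ∈ U) (hN : ∃ k, ∀ x ∈ U, (N ^ k) x = 0) :
    HasJordanBasis N {(0 : K)} U := by
  induction hd : finrank K U using Nat.strong_induction_on generalizing U with
  | _ d ih =>
    rcases eq_or_ne U ⊥ with rfl | hU
    · exact HasJordanBasis.bot _ _
    classical
    have hm := Nat.find_spec hN
    have hmin := fun k => Nat.find_min hN (m := k)
    set m := Nat.find hN
    have hm0 : 0 < m := by
      rw [Nat.pos_iff_ne_zero]
      intro h0
      rw [h0] at hm
      exact hU (eq_bot_iff.2 fun x hx => by simpa using hm x hx)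
    have := hmin (m - 1) (by omega)
    push Not at this
    obtain ⟨v, hvU, hv⟩ := this
    obtain ⟨φ, hφ⟩ := exists_functional_eq_one (K := K) hv
    have hNp : ∀ i, ∀ x ∈ U, (N ^ i) x ∈ U := by
      intro i
      induction i with
      | zero => exact fun x hx => by simpa using hx
      | succ i ih => exact fun x hx => by rw [pow_succ]; exact ih _ (hNU x hx)
    have hvm : (N ^ m) v = 0 := hm v hvU
    let S := span K (Set.range fun j : Fin m => (N ^ (j : ℕ)) v)
    have hSU : S ≤ U := span_le.2 (by rintro _ ⟨j, rfl⟩; exact hNp _ _ hvU)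
    -- The largest `N`-stable subspace of `U` on which `φ` vanishes; it complements the chain of
    -- maximal length.
    let W : Submodule K V := U ⊓ ⨅ i : ℕ, LinearMap.ker (φ ∘ₗ (N ^ i))
    have hWmem : ∀ x, x ∈ W ↔ x ∈ U ∧ ∀ i, φ ((N ^ i) x) = 0 := fun x => by
      simp [W, Submodule.mem_iInf]
    have hWU : W ≤ U := inf_le_left
    have hdisj : Disjoint S W := by
      rw [Submodule.disjoint_def]
      intro x hxS hxW
      obtain ⟨a, rfl⟩ := (Submodule.mem_span_range_iff_exists_fun K).1 hxS
      exact Finset.sum_eq_zero fun j _ => by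
        rw [chain_coeff_eq_zero N φ hvm hφ a ((hWmem _).1 hxW).2 j, zero_smul]
    have hsup : S ⊔ W = U := by
      refine le_antisymm (sup_le hSU hWU) fun x hx => ?_
      obtain ⟨w, hw, h⟩ := exists_mem_span_chain N φ hvm hφ x (hm x hx)
      rw [← add_sub_cancel w x]
      exact add_mem (mem_sup_left hw) (mem_sup_right ((hWmem _).2 ⟨sub_mem hx (hSU hw), h⟩))
    have hvS : v ∈ S := subset_span ⟨⟨0, hm0⟩, by simp⟩
    have hlt : W < U := lt_of_le_of_ne hWU fun h => by
      have h0 := (Submodule.disjoint_def.1 hdisj) v hvS (h ▸ hvU)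
      rw [h0, map_zero] at hv
      exact hv rfl
    have : FiniteDimensional K W := Submodule.finiteDimensional_of_le hWU
    have hS : HasJordanBasis N {(0 : K)} S := hasJordanBasis_span_chain N hm0 hvm <|
      Fintype.linearIndependent_iff.2 fun a ha j =>
        chain_coeff_eq_zero N φ hvm hφ a (fun i => by rw [ha, map_zero, map_zero]) j
    have hW : HasJordanBasis N {(0 : K)} W := by
      refine ih _ (hd ▸ Submodule.finrank_lt_finrank_of_lt hlt) W (fun x hx => ?_)
        ⟨m, fun x hx => hm x (hWU hx)⟩ rfl
      rw [hWmem] at hx ⊢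
      refine ⟨hNU x hx.1, fun i => ?_⟩
      rw [← Module.End.mul_apply, ← pow_succ]
      exact hx.2 _
    exact hsup ▸ hS.sup hW hdisj

end JordanBasis

/-! ### The quaternions as a complex plane -/

/-- Left multiplication by complex numbers makes the quaternions a complex vector space. -/
instance complexModule : Module ℂ (Quaternion ℝ) :=
  Module.compHom (Quaternion ℝ) Quaternion.ofComplex.toRingHom

theorem complex_smul_def (c : ℂ) (q : Quaternion ℝ) : c • q = (c : Quaternion ℝ) * q := rfl

instance complexTower : IsScalarTower ℂ (Quaternion ℝ) (Quaternion ℝ) :=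
  ⟨fun c p q => by simp only [complex_smul_def, smul_eq_mul, mul_assoc]⟩

/-- The quaternion unit `j`. -/
def unitJ : Quaternion ℝ := ⟨0, 0, 1, 0⟩

@[simp] theorem unitJ_re : unitJ.re = 0 := rfl
@[simp] theorem unitJ_imI : unitJ.imI = 0 := rfl
@[simp] theorem unitJ_imJ : unitJ.imJ = 1 := rfl
@[simp] theorem unitJ_imK : unitJ.imK = 0 := rfl

theorem unitJ_mul_unitJ : unitJ * unitJ = -1 := by
  ext <;> simp <;> rfl

theorem unitJ_mul_coe (c : ℂ) :
    unitJ * (c : Quaternion ℝ) = (((starRingEnd ℂ) c : ℂ) : Quaternion ℝ) * unitJ := by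
  ext <;> simp

theorem eq_cpart_add_jpart_mul (q : Quaternion ℝ) :
    q = (cpart q : Quaternion ℝ) + (jpart q : Quaternion ℝ) * unitJ := by
  ext <;> simp [cpart, jpart]

/-- The complex basis `1, j` of the quaternions. -/
def quatBasis : Basis (Fin 2) ℂ (Quaternion ℝ) :=
  Basis.ofEquivFun
    { toFun := fun q => ![cpart q, jpart q]
      invFun := fun a => (a 0 : Quaternion ℝ) + (a 1 : Quaternion ℝ) * unitJ
      left_inv := fun q => (eq_cpart_add_jpart_mul q).symm
      right_inv := fun a => by
        ext s; fin_cases s <;> apply Complex.ext <;> simp [cpart, jpart]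
      map_add' := fun p q => by
        ext s; fin_cases s <;> apply Complex.ext <;> simp [cpart, jpart]
      map_smul' := fun c q => by
        ext s; fin_cases s <;> apply Complex.ext <;>
          simp [cpart, jpart, complex_smul_def] }

theorem quatBasis_repr (q : Quaternion ℝ) (s : Fin 2) :
    quatBasis.repr q s = ![cpart q, jpart q] s := rfl

theorem quatBasis_zero : quatBasis 0 = 1 := by
  rw [Basis.apply_eq_iff]
  ext s
  fin_cases s <;> simp [quatBasis_repr] <;> apply Complex.ext <;> simp [cpart, jpart] <;> rfl

theorem quatBasis_one : quatBasis 1 = unitJ := by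
  rw [Basis.apply_eq_iff]
  ext s
  fin_cases s <;> simp [quatBasis_repr] <;> apply Complex.ext <;> simp [cpart, jpart]

instance complexFinite : Module.Finite ℂ (Quaternion ℝ) := Module.Finite.of_basis quatBasis

/-! ### Generalized eigenspaces and Jordan bases of quaternionic operators -/

section QuaternionicSpace

variable {V : Type*} [AddCommGroup V] [Module (Quaternion ℝ) V] [Module ℂ V]
  [IsScalarTower ℂ (Quaternion ℝ) V]

theorem complex_smul_eq (c : ℂ) (v : V) : c • v = (c : Quaternion ℝ) • v := by
  conv_lhs => rw [← one_smul (Quaternion ℝ) v, ← smul_assoc, complex_smul_def, mul_one]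

theorem unitJ_smul_smul (c : ℂ) (v : V) : unitJ • c • v = (starRingEnd ℂ) c • unitJ • v := by
  rw [complex_smul_eq, complex_smul_eq, smul_smul, smul_smul, unitJ_mul_coe]

theorem unitJ_smul_unitJ_smul {V : Type*} [AddCommGroup V] [Module (Quaternion ℝ) V] (v : V) :
     unitJ • unitJ • v = -v := by
  rw [smul_smul, unitJ_mul_unitJ, neg_smul, one_smul]

theorem quat_smul_eq (q : Quaternion ℝ) (v : V) :
    q • v = cpart q • v + unitJ • (starRingEnd ℂ) (jpart q) • v := by
  conv_lhs => rw [eq_cpart_add_jpart_mul q]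
  rw [unitJ_smul_smul, Complex.conj_conj, add_smul, mul_smul, complex_smul_eq, complex_smul_eq]

/-- The complex-linear map `f - z`. -/
def shift (f : End (Quaternion ℝ) V) (z : ℂ) : End ℂ V :=
  f.restrictScalars ℂ - algebraMap ℂ (End ℂ V) z

theorem shift_apply (f : End (Quaternion ℝ) V) (z : ℂ) (x : V) : shift f z x = f x - z • x := rfl

theorem shift_commute (f : End (Quaternion ℝ) V) (z w : ℂ) : Commute (shift f z) (shift f w) := by
  refine LinearMap.ext fun x => ?_
  simp only [Module.End.mul_apply, shift_apply, map_sub, ← LinearMap.coe_restrictScalars ℂ f,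
    map_smul, smul_sub, smul_comm w z]
  abel

/-- `f` commutes with `j` while complex scalars are conjugated on passing it, so `j` exchanges the
generalized eigenspaces of `z` and its conjugate. -/
theorem unitJ_smul_shift_pow (f : End (Quaternion ℝ) V) (z : ℂ) (k : ℕ) (x : V) :
    unitJ • (shift f z ^ k) x = (shift f ((starRingEnd ℂ) z) ^ k) (unitJ • x) := by
  induction k generalizing x with
  | zero => rfl
  | succ k ih =>
    rw [pow_succ, pow_succ, Module.End.mul_apply, Module.End.mul_apply, ih, shift_apply,
      shift_apply, smul_sub, unitJ_smul_smul, map_smul]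

/-- Multiplication by a real number. -/
def realMul (V : Type*) [AddCommGroup V] [Module (Quaternion ℝ) V] (r : ℝ) :
    End (Quaternion ℝ) V where
  toFun v := (r : Quaternion ℝ) • v
  map_add' := smul_add _
  map_smul' q v := by rw [RingHom.id_apply, smul_smul, smul_smul, Quaternion.coe_commutes]

theorem realMul_apply (r : ℝ) (v : V) : realMul V r v = (r : ℂ) • v := by
  rw [complex_smul_eq, Quaternion.coeComplex_coe]; rfl

/-- The quaternionic linear map `(f - z) (f - conj z)`. -/
def quad {V : Type*} [AddCommGroup V] [Module (Quaternion ℝ) V] (f : End (Quaternion ℝ) V)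
    (z : ℂ) : End (Quaternion ℝ) V :=
  f * f - realMul V (2 * z.re) * f + realMul V (Complex.normSq z)

/-- Each factor is only complex linear, but the product has real, hence central, coefficients: its
kernels and ranges are quaternionic subspaces. -/
theorem quad_apply (f : End (Quaternion ℝ) V) (z : ℂ) (x : V) :
    quad f z x = (shift f ((starRingEnd ℂ) z) * shift f z) x := by
  simp only [quad, LinearMap.add_apply, LinearMap.sub_apply, Module.End.mul_apply, shift_apply,
    realMul_apply, map_sub, smul_smul, ← Complex.normSq_eq_conj_mul_self]
  rw [← LinearMap.coe_restrictScalars ℂ f, map_smul, ← Complex.add_conj, add_smul]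
  abel

theorem quad_pow_apply (f : End (Quaternion ℝ) V) (z : ℂ) (k : ℕ) (x : V) :
    (quad f z ^ k) x = (shift f ((starRingEnd ℂ) z) ^ k) ((shift f z ^ k) x) := by
  rw [← Module.End.mul_apply, ← (shift_commute f _ _).mul_pow]
  induction k generalizing x with
  | zero => rfl
  | succ k ih => rw [pow_succ, pow_succ, Module.End.mul_apply, Module.End.mul_apply, ih, quad_apply]

theorem quad_comm {V : Type*} [AddCommGroup V] [Module (Quaternion ℝ) V] (f : End (Quaternion ℝ) V) (z : ℂ) :
    Commute f (quad f z) := by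
  have h : ∀ r, Commute f (realMul V r) := fun r => LinearMap.ext fun x => map_smul f _ x
  exact (((Commute.refl f).mul_right (Commute.refl f)).sub_right
    ((h _).mul_right (Commute.refl f))).add_right (h _)

theorem shift_pow_eq_aeval (f : End (Quaternion ℝ) V) (z : ℂ) (k : ℕ) :
    shift f z ^ k =
      Polynomial.aeval (f.restrictScalars ℂ : End ℂ V) ((Polynomial.X - Polynomial.C z) ^ k) := by
  simp [shift]

theorem isCoprime_X_sub_C_pow {z w : ℂ} (h : z ≠ w) (k : ℕ) :
    IsCoprime ((Polynomial.X - Polynomial.C z) ^ k) ((Polynomial.X - Polynomial.C w) ^ k) :=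
  (Polynomial.isCoprime_X_sub_C_of_isUnit_sub (sub_ne_zero.2 h).isUnit).pow

theorem disjoint_ker_shift_pow (f : End (Quaternion ℝ) V) {z w : ℂ} (h : z ≠ w) (k : ℕ) :
    Disjoint (LinearMap.ker (shift f z ^ k)) (LinearMap.ker (shift f w ^ k)) := by
  rw [shift_pow_eq_aeval, shift_pow_eq_aeval]
  exact Polynomial.disjoint_ker_aeval_of_isCoprime _ (isCoprime_X_sub_C_pow h k)

theorem sup_ker_shift_pow (f : End (Quaternion ℝ) V) {z w : ℂ} (h : z ≠ w) (k : ℕ) :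
    LinearMap.ker (shift f z ^ k) ⊔ LinearMap.ker (shift f w ^ k) =
      LinearMap.ker (shift f z ^ k * shift f w ^ k) := by
  rw [shift_pow_eq_aeval, shift_pow_eq_aeval,
    Polynomial.sup_ker_aeval_eq_ker_aeval_mul_of_coprime _ (isCoprime_X_sub_C_pow h k), map_mul]

/-- The complex numbers with non-negative imaginary part, as quaternions. -/
def upperHalf : Set (Quaternion ℝ) := {q | ∃ z : ℂ, 0 ≤ z.im ∧ q = z}

/-- For real `r` the map `f - r` is itself quaternionic linear with square `quad f r`, so the
nilpotent case applies over the quaternions. -/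
theorem hasJordanBasis_ker_quad_of_real [FiniteDimensional (Quaternion ℝ) V]
    (f : End (Quaternion ℝ) V) (r : ℝ) (k : ℕ) :
    HasJordanBasis f upperHalf (LinearMap.ker (quad f r ^ k)) := by
  let N : End (Quaternion ℝ) V := f - realMul V r
  have hN : ∀ x, N x = shift f r x := fun x => by
    rw [shift_apply, ← realMul_apply]; rfl
  have hq : quad f r = N * N := LinearMap.ext fun x => by
    rw [quad_apply, Module.End.mul_apply, Module.End.mul_apply, hN, hN, Complex.conj_ofReal]
  have hc : Commute N (quad f r ^ k) := by
    rw [hq]; exact ((Commute.refl N).mul_right (Commute.refl N)).pow_right k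
  obtain ⟨ι, _, c, m, b, hc, hm, hb, hz, hi, hs⟩ := hasJordanBasis_of_nilpotent N
    (LinearMap.ker (quad f r ^ k))
    (fun x hx => by
      rw [LinearMap.mem_ker] at hx ⊢
      rw [← Module.End.mul_apply, ← hc.eq, Module.End.mul_apply, hx, map_zero])
    ⟨2 * k, fun x hx => by rw [pow_mul, pow_two, ← hq]; exact hx⟩
  refine ⟨ι, inferInstance, fun _ => ((r : ℂ) : Quaternion ℝ), m, b,
    fun _ => ⟨r, by simp, rfl⟩, hm, fun i j => ?_, hz, hi, hs⟩
  have h := hb i j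
  rw [hN, shift_apply, Set.mem_singleton_iff.1 (hc i), zero_smul, zero_add,
    sub_eq_iff_eq_add', complex_smul_eq] at h
  exact h

/-- With `E = ker (f - z)^k`, the kernel is `E ⊕ jE` because `z` differs from its conjugate. A
complex Jordan basis of `E` is then a quaternionic one of the sum. -/
theorem hasJordanBasis_ker_quad_of_pos [FiniteDimensional ℂ V]
    (f : End (Quaternion ℝ) V) {z : ℂ} (hz : 0 < z.im) (k : ℕ) :
    HasJordanBasis f upperHalf (LinearMap.ker (quad f z ^ k)) := by
  have hne : z ≠ (starRingEnd ℂ) z := fun h => by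
    have := congrArg Complex.im h
    rw [Complex.conj_im] at this; linarith
  have hd := disjoint_ker_shift_pow f hne k
  obtain ⟨ι, _, c, m, b, hc, hm, hb, hbz, hi, hs⟩ := hasJordanBasis_of_nilpotent (shift f z)
    (LinearMap.ker (shift f z ^ k))
    (fun x hx => by
      rw [LinearMap.mem_ker] at hx ⊢
      rw [← Module.End.mul_apply, ← pow_succ, pow_succ', Module.End.mul_apply, hx, map_zero])
    ⟨k, fun x hx => hx⟩
  have hbE : ∀ x : Σ i, Fin (m i), b x.1 x.2 ∈ LinearMap.ker (shift f z ^ k) := fun x => by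
    rw [← hs]; exact subset_span ⟨x, rfl⟩
  refine ⟨ι, inferInstance, fun _ => (z : Quaternion ℝ), m, b,
    fun _ => ⟨z, hz.le, rfl⟩, hm, fun i j => ?_, hbz, ?_, le_antisymm ?_ fun x hx => ?_⟩
  · have h := hb i j
    rw [shift_apply, Set.mem_singleton_iff.1 (hc i), zero_smul, zero_add,
      sub_eq_iff_eq_add', complex_smul_eq] at h
    exact h
  · rw [Fintype.linearIndependent_iff] at hi ⊢
    intro q hq
    -- A quaternionic relation splits into components in `E` and `jE`, each a complex relation among
    -- the basis vectors of `E`.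
    rw [Finset.sum_congr rfl fun x _ => quat_smul_eq (q x) (b x.1 x.2), Finset.sum_add_distrib,
      ← Finset.smul_sum] at hq
    have h1 : ∑ x : Σ i, Fin (m i), cpart (q x) • b x.1 x.2 ∈ LinearMap.ker (shift f z ^ k) :=
      sum_mem fun x _ => smul_mem _ _ (hbE x)
    have h2 : ∑ x : Σ i, Fin (m i), (starRingEnd ℂ) (jpart (q x)) • b x.1 x.2 ∈
        LinearMap.ker (shift f z ^ k) := sum_mem fun x _ => smul_mem _ _ (hbE x)
    have h3 : unitJ • ∑ x : Σ i, Fin (m i), (starRingEnd ℂ) (jpart (q x)) • b x.1 x.2 ∈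
        LinearMap.ker (shift f ((starRingEnd ℂ) z) ^ k) := by
      rw [LinearMap.mem_ker, ← unitJ_smul_shift_pow, LinearMap.mem_ker.1 h2, smul_zero]
    have h4 := Submodule.disjoint_def.1 hd _ h1
      (by rw [eq_neg_of_add_eq_zero_left hq]; exact neg_mem h3)
    rw [h4, zero_add] at hq
    have h5 := congrArg (fun y => unitJ • y) hq
    simp only [unitJ_smul_unitJ_smul, smul_zero, neg_eq_zero] at h5
    intro x
    have h6 := hi _ h4 x
    have h7 := hi _ h5 x
    rw [map_eq_zero] at h7
    rw [eq_cpart_add_jpart_mul (q x), h6, h7]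
    simp
  · rw [span_le]
    rintro _ ⟨x, rfl⟩
    rw [SetLike.mem_coe, LinearMap.mem_ker, quad_pow_apply, LinearMap.mem_ker.1 (hbE x), map_zero]
  · have hE : ∀ y ∈ LinearMap.ker (shift f z ^ k),
        y ∈ span (Quaternion ℝ) (Set.range fun x : Σ i, Fin (m i) => b x.1 x.2) := by
      intro y hy
      rw [← hs] at hy
      have : span ℂ (Set.range fun x : Σ i, Fin (m i) => b x.1 x.2) ≤
          (span (Quaternion ℝ) (Set.range fun x : Σ i, Fin (m i) => b x.1 x.2)).restrictScalars ℂ :=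
        span_le.2 subset_span
      exact this hy
    have hx' : x ∈ LinearMap.ker (shift f z ^ k) ⊔
        LinearMap.ker (shift f ((starRingEnd ℂ) z) ^ k) := by
      rw [sup_ker_shift_pow f hne, LinearMap.mem_ker,
        ((shift_commute f _ _).pow_pow k k).eq, Module.End.mul_apply, ← quad_pow_apply]
      exact hx
    obtain ⟨y, hy, w, hw, rfl⟩ := mem_sup.1 hx'
    refine add_mem (hE y hy) ?_
    rw [← neg_neg w, ← unitJ_smul_unitJ_smul w]
    refine neg_mem (smul_mem _ _ (hE _ ?_))
    have h := unitJ_smul_shift_pow f ((starRingEnd ℂ) z) k w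
    rw [LinearMap.mem_ker.1 hw, smul_zero, Complex.conj_conj] at h
    exact h.symm

theorem exists_eigenvector_im_nonneg [FiniteDimensional ℂ V] [Nontrivial V]
    (f : End (Quaternion ℝ) V) : ∃ (z : ℂ) (v : V), 0 ≤ z.im ∧ v ≠ 0 ∧ f v = z • v := by
  obtain ⟨z, hz⟩ := Module.End.exists_eigenvalue (f.restrictScalars ℂ : End ℂ V)
  obtain ⟨v, hv⟩ := hz.exists_hasEigenvector
  have hv1 : f v = z • v := hv.apply_eq_smul
  rcases le_total 0 z.im with h | h
  · exact ⟨z, v, h, hv.2, hv1⟩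
  · refine ⟨(starRingEnd ℂ) z, unitJ • v, by rw [Complex.conj_im]; linarith, fun h0 => hv.2 ?_, ?_⟩
    · rw [← neg_eq_zero, ← unitJ_smul_unitJ_smul, h0, smul_zero]
    · rw [map_smul, hv1, unitJ_smul_smul]

end QuaternionicSpace

/-- Every endomorphism of a finite-dimensional quaternionic vector space has a Jordan basis. -/
theorem hasJordanBasis_quaternion (V : Type*) [AddCommGroup V] [Module (Quaternion ℝ) V]
    [Module ℂ V] [IsScalarTower ℂ (Quaternion ℝ) V] [FiniteDimensional (Quaternion ℝ) V]
    (f : End (Quaternion ℝ) V) : HasJordanBasis f upperHalf ⊤ := by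
  induction hd : finrank (Quaternion ℝ) V using Nat.strong_induction_on generalizing V with
  | _ d ih =>
    rcases subsingleton_or_nontrivial V with hV | hV
    · rw [Subsingleton.elim (⊤ : Submodule (Quaternion ℝ) V) ⊥]
      exact HasJordanBasis.bot _ _
    have : FiniteDimensional ℂ V := Module.Finite.trans (Quaternion ℝ) V
    obtain ⟨z, v, hz, hv, hfv⟩ := exists_eigenvector_im_nonneg f
    -- Fitting decomposition of `quad f z`. Positivity of `k` puts the eigenvector in the kernel, so
    -- the range is proper and the induction applies to it.
    obtain ⟨k, hk, hk0⟩ := ((quad f z).eventually_isCompl_ker_pow_range_pow.and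
      (Filter.eventually_gt_atTop 0)).exists
    have hker : HasJordanBasis f upperHalf (LinearMap.ker (quad f z ^ k)) := by
      rcases hz.eq_or_lt with h | h
      · rw [show z = ((z.re : ℝ) : ℂ) from Complex.ext rfl h.symm]
        exact hasJordanBasis_ker_quad_of_real f _ k
      · exact hasJordanBasis_ker_quad_of_pos f h k
    have hvker : v ∈ LinearMap.ker (quad f z ^ k) := by
      obtain ⟨l, rfl⟩ : ∃ l, k = l + 1 := ⟨k - 1, by omega⟩
      rw [LinearMap.mem_ker, quad_pow_apply, pow_succ (shift f z), Module.End.mul_apply, shift_apply,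
        hfv, sub_self, map_zero, map_zero]
    let R := LinearMap.range (quad f z ^ k)
    have hR : ∀ x ∈ R, f x ∈ R := by
      rintro _ ⟨y, rfl⟩
      exact ⟨f y, by
        rw [← Module.End.mul_apply, ← Module.End.mul_apply, ((quad_comm f z).pow_right k).eq]⟩
    have hRlt : R < ⊤ := lt_top_iff_ne_top.2 fun h => by
      have := Submodule.disjoint_def.1 hk.disjoint v hvker
        (by change v ∈ R; rw [h]; exact mem_top)
      exact hv this
    have hRJ : HasJordanBasis f upperHalf R := by
      have := (ih _ (hd ▸ Submodule.finrank_lt hRlt.ne) R (f.restrict hR) rfl).map R.subtype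
        R.injective_subtype f fun x => rfl
      rwa [Submodule.map_top, Submodule.range_subtype] at this
    rw [← hk.sup_eq_top]
    exact hker.sup hRJ hk.disjoint

/-! ### Kernels of powers of an operator in Jordan form -/

section KernelDimension

variable {K V : Type*} [Field K] [AddCommGroup V] [Module K V] {ι : Type*} {m : ι → ℕ}

theorem repr_apply_of_chains (b : Basis (Σ i, Fin (m i)) K V) (N : End K V) (a : ι → K)
    (hN : ∀ i j (hj : j < m i), N (b ⟨i, ⟨j, hj⟩⟩) =
      a i • b ⟨i, ⟨j, hj⟩⟩ + if h : j + 1 < m i then b ⟨i, ⟨j + 1, h⟩⟩ else 0)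
    (x : V) (i : ι) (j : ℕ) (hj : j < m i) :
    b.repr (N x) ⟨i, ⟨j, hj⟩⟩ = a i * b.repr x ⟨i, ⟨j, hj⟩⟩ +
      if 0 < j then b.repr x ⟨i, ⟨j - 1, by omega⟩⟩ else 0 := by
  classical
  suffices H : b.coord ⟨i, ⟨j, hj⟩⟩ ∘ₗ N = a i • b.coord ⟨i, ⟨j, hj⟩⟩ +
      if 0 < j then b.coord ⟨i, ⟨j - 1, by omega⟩⟩ else 0 by
    have h := LinearMap.congr_fun H x
    split_ifs at h ⊢ <;> simpa using h
  refine b.ext ?_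
  rintro ⟨i', ⟨j', hj'⟩⟩
  have hsig : ∀ (l l' : ℕ) (hl : l < m i) (hl' : l' < m i'),
      b.repr (b ⟨i', ⟨l', hl'⟩⟩) ⟨i, ⟨l, hl⟩⟩ = if i' = i ∧ l' = l then 1 else 0 := by
    intro l l' hl hl'
    rw [Basis.repr_self, Finsupp.single_apply]
    refine if_congr ?_ rfl rfl
    constructor
    · intro h
      obtain ⟨rfl, h⟩ := Sigma.mk.inj_iff.1 h
      exact ⟨rfl, by simpa using h⟩
    · rintro ⟨rfl, rfl⟩; rfl
  rw [LinearMap.comp_apply, hN, map_add, map_smul, LinearMap.add_apply, LinearMap.smul_apply]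
  simp only [Basis.coord_apply, hsig]
  congr 1
  · by_cases h : i' = i ∧ j' = j
    · rw [h.1]
    · rw [if_neg h, smul_zero, smul_zero]
  · by_cases h0 : 0 < j
    · rw [if_pos h0, Basis.coord_apply, hsig]
      split_ifs with h1 h2 h2
      · rw [hsig, if_pos ⟨h2.1, by omega⟩]
      · rw [hsig, if_neg fun h => h2 ⟨h.1, by omega⟩]
      · exact absurd (by rw [h2.1]; omega) h1
      · simp
    · rw [if_neg h0]
      split_ifs with h1
      · rw [hsig, if_neg fun h => by omega, LinearMap.zero_apply]
      · simp

theorem sum_fin_ite_le_add (m k : ℕ) : (∑ j : Fin m, if m ≤ (j : ℕ) + k then 1 else 0) = min k m := by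
  rw [Fin.sum_univ_eq_sum_range (fun j => if m ≤ j + k then 1 else 0), ← Finset.card_filter]
  have : (Finset.range m).filter (fun j => m ≤ j + k) = Finset.Ico (m - k) m := by
    ext j; simp only [Finset.mem_filter, Finset.mem_range, Finset.mem_Ico]; omega
  rw [this, Nat.card_Ico]; omega

/-- The dimension of the kernel of a power of an operator in Jordan form. -/
theorem finrank_ker_pow_of_chains [Fintype ι] [DecidableEq K]
    (b : Basis (Σ i, Fin (m i)) K V) (N : End K V)
    (a : ι → K) (hN : ∀ i j (hj : j < m i), N (b ⟨i, ⟨j, hj⟩⟩) =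
      a i • b ⟨i, ⟨j, hj⟩⟩ + if h : j + 1 < m i then b ⟨i, ⟨j + 1, h⟩⟩ else 0) (k : ℕ) :
    finrank K (LinearMap.ker (N ^ k)) = ∑ i, if a i = 0 then min k (m i) else 0 := by
  classical
  -- The last `k` vectors of each chain with `a i = 0` (the whole chain if it is shorter); they will
  -- span the kernel.
  let S : Set (Σ i, Fin (m i)) := {p | a p.1 = 0 ∧ m p.1 ≤ (p.2 : ℕ) + k}
  have h1 : ∀ k i j (hj : j < m i), a i = 0 → m i ≤ j + k → (N ^ k) (b ⟨i, ⟨j, hj⟩⟩) = 0 := by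
    intro k
    induction k with
    | zero => intros; omega
    | succ k ih =>
      intro i j hj ha hk
      rw [pow_succ, Module.End.mul_apply, hN, ha, zero_smul, zero_add]
      split_ifs with h
      · exact ih i (j + 1) h ha (by omega)
      · exact map_zero _
  have h2 : ∀ k x, (N ^ k) x = 0 → ∀ i j (hj : j < m i), b.repr x ⟨i, ⟨j, hj⟩⟩ ≠ 0 →
      a i = 0 ∧ m i ≤ j + k := by
    intro k
    induction k with
    | zero =>
      intro x hx i j hj h
      rw [show x = 0 from hx] at h
      simp at h
    | succ k ih =>
      intro x hx i j hj
      have hNx : ∀ i j (hj : j < m i), ¬(a i = 0 ∧ m i ≤ j + k) →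
          a i * b.repr x ⟨i, ⟨j, hj⟩⟩ +
            (if 0 < j then b.repr x ⟨i, ⟨j - 1, by omega⟩⟩ else 0) = 0 := by
        intro i j hj h
        rw [← repr_apply_of_chains b N a hN]
        by_contra h'
        exact h (ih (N x) (by rwa [pow_succ] at hx) i j hj h')
      contrapose!
      by_cases ha : a i = 0
      · intro h
        have := hNx i (j + 1) (by have := h ha; omega) (fun h' => by have := h ha; omega)
        simpa [ha] using this
      · intro h
        clear h
        -- On a chain with `a i ≠ 0`, the coordinates of a kernel vector vanish successively,
        -- starting at the head.
        induction j with
        | zero => simpa [ha] using hNx i 0 hj fun h => ha h.1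
        | succ j ihj =>
          have h := hNx i (j + 1) hj fun h => ha h.1
          have h' : b.repr x ⟨i, ⟨j + 1 - 1, by omega⟩⟩ = 0 := ihj (by omega) hNx
          rw [if_pos j.succ_pos, h', add_zero] at h
          exact (mul_eq_zero.1 h).resolve_left ha
  have hker : LinearMap.ker (N ^ k) = span K (b '' S) := by
    refine le_antisymm (fun x hx => ?_) (span_le.2 ?_)
    · rw [b.mem_span_image]
      rintro ⟨i, ⟨j, hj⟩⟩ hp
      exact h2 k x hx i j hj (Finsupp.mem_support_iff.1 hp)
    · rintro _ ⟨⟨i, ⟨j, hj⟩⟩, hp, rfl⟩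
      exact h1 k i j hj hp.1 hp.2
  rw [hker, Set.image_eq_range, finrank_span_eq_card (b := fun x : S => b x)
    (b.linearIndependent.comp _ Subtype.val_injective), Fintype.card_subtype, Finset.card_filter, Fintype.sum_sigma]
  refine Finset.sum_congr rfl fun i _ => ?_
  by_cases ha : a i = 0
  · simp only [S, Set.mem_ofPred_eq, ha, true_and, if_true]
    exact sum_fin_ite_le_add _ _
  · simp [S, ha]

end KernelDimension

/-! ### Block multiplicities from kernel dimensions -/

section Multiplicity

variable {V : Type*} [AddCommGroup V] [Module (Quaternion ℝ) V] {ι : Type*} {m : ι → ℕ}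

/-- `b` is a basis in which `f` is in Jordan form. -/
def IsJordanBasis (f : End (Quaternion ℝ) V) (eig : ι → ℂ)
    (b : Basis (Σ i, Fin (m i)) (Quaternion ℝ) V) : Prop :=
  ∀ i j (hj : j < m i), f (b ⟨i, ⟨j, hj⟩⟩) = (eig i : Quaternion ℝ) • b ⟨i, ⟨j, hj⟩⟩ +
    if h : j + 1 < m i then b ⟨i, ⟨j + 1, h⟩⟩ else 0

/-- Regrouping of the complex basis attached to a quaternionic Jordan basis. -/
def doubleSigma (m : ι → ℕ) :
    (Fin 2 × Σ i, Fin (m i)) ≃ Σ p : Fin 2 × ι, Fin (m p.2) where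
  toFun x := ⟨(x.1, x.2.1), x.2.2⟩
  invFun y := (y.1.1, ⟨y.1.2, y.2⟩)
  left_inv _ := rfl
  right_inv _ := rfl

variable [Module ℂ V] [IsScalarTower ℂ (Quaternion ℝ) V]

/-- A quaternionic chain with eigenvalue λ splits over ℂ into two chains: itself, and its image
under `j` with conjugate eigenvalue. -/
theorem finrank_ker_shift_pow [Fintype ι] {f : End (Quaternion ℝ) V} {eig : ι → ℂ}
    {b : Basis (Σ i, Fin (m i)) (Quaternion ℝ) V} (hb : IsJordanBasis f eig b) (z : ℂ) (k : ℕ) :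
    finrank ℂ (LinearMap.ker (shift f z ^ k)) =
      (∑ i, if eig i = z then min k (m i) else 0) +
        ∑ i, if (starRingEnd ℂ) (eig i) = z then min k (m i) else 0 := by
  let μ : Fin 2 × ι → ℂ := fun p => ![eig p.2, (starRingEnd ℂ) (eig p.2)] p.1
  rw [finrank_ker_pow_of_chains (m := fun p : Fin 2 × ι => m p.2)
    ((quatBasis.smulTower b).reindex (doubleSigma m)) (shift f z) (fun p => μ p - z),
    Fintype.sum_prod_type, Fin.sum_univ_two]
  · exact congrArg₂ _ (Finset.sum_congr rfl fun i _ => if_congr sub_eq_zero rfl rfl)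
      (Finset.sum_congr rfl fun i _ => if_congr sub_eq_zero rfl rfl)
  · rintro ⟨s, i⟩ j hj
    have hB : ∀ j (hj : j < m i), ((quatBasis.smulTower b).reindex (doubleSigma m))
        ⟨(s, i), ⟨j, hj⟩⟩ = quatBasis s • b ⟨i, ⟨j, hj⟩⟩ := fun j hj => by
      rw [Basis.reindex_apply, Basis.smulTower_apply]; rfl
    have h2 : ∀ v : V, quatBasis s • (eig i : Quaternion ℝ) • v = μ (s, i) • quatBasis s • v := by
      intro v
      fin_cases s
      · simp [μ, quatBasis_zero, complex_smul_eq]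
      · simp [μ, quatBasis_one, ← complex_smul_eq, unitJ_smul_smul]
    rw [hB, shift_apply, map_smul, hb i j hj, smul_add, h2, sub_smul, add_sub_right_comm]
    congr 1
    split_ifs with h
    · rw [hB]
    · exact smul_zero _

theorem finrank_ker_shift_pow_of_im_nonneg [Fintype ι] {f : End (Quaternion ℝ) V} {eig : ι → ℂ}
    {b : Basis (Σ i, Fin (m i)) (Quaternion ℝ) V} (hb : IsJordanBasis f eig b)
    (heig : ∀ i, 0 ≤ (eig i).im) {z : ℂ} (hz : 0 ≤ z.im) (k : ℕ) :
    finrank ℂ (LinearMap.ker (shift f z ^ k)) =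
      (if z.im = 0 then 2 else 1) * ∑ i, if eig i = z then min k (m i) else 0 := by
  rw [finrank_ker_shift_pow hb]
  have h : ∀ i, (starRingEnd ℂ) (eig i) = z ↔ eig i = z ∧ z.im = 0 := by
    intro i
    constructor
    · rintro rfl
      rw [Complex.conj_im] at hz ⊢
      have := heig i
      have h0 : (eig i).im = 0 := by linarith
      exact ⟨Complex.ext (by simp) (by simp [h0]), by linarith⟩
    · rintro ⟨rfl, h0⟩
      exact Complex.conj_eq_iff_im.2 h0
  simp only [h]
  split_ifs with h0
  · simp [two_mul, h0]
  · simp [h0]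

/-- The negated second difference of `min · (m i)` at `s > 0` is 1 when `m i = s` and 0 otherwise.
-/
theorem two_mul_sum_min [Fintype ι] (P : ι → Prop) [DecidablePred P] (m : ι → ℕ) {s : ℕ}
    (hs : 0 < s) :
    2 * (∑ i, if P i then min s (m i) else 0) =
      (∑ i, if P i then min (s - 1) (m i) else 0) + (∑ i, if P i then min (s + 1) (m i) else 0) +
        Nat.card {i // P i ∧ m i = s} := by
  classical
  rw [Nat.card_eq_fintype_card, Fintype.card_subtype, Finset.card_filter, Finset.mul_sum,
    ← Finset.sum_add_distrib, ← Finset.sum_add_distrib]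
  refine Finset.sum_congr rfl fun i _ => ?_
  by_cases h : P i
  · by_cases h1 : m i = s
    · simp only [h, h1, if_true, and_self]; omega
    · simp only [h, h1, if_true, and_false, if_false]; omega
  · simp [h]

/-- The multiplicity of a Jordan block in terms of dimensions of kernels. -/
theorem multiplicity_mul_eq [Fintype ι] {f : End (Quaternion ℝ) V} {eig : ι → ℂ}
    {b : Basis (Σ i, Fin (m i)) (Quaternion ℝ) V} (hb : IsJordanBasis f eig b)
    (heig : ∀ i, 0 ≤ (eig i).im) {z : ℂ} (hz : 0 ≤ z.im) {s : ℕ} (hs : 0 < s) :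
    2 * finrank ℂ (LinearMap.ker (shift f z ^ s)) =
      finrank ℂ (LinearMap.ker (shift f z ^ (s - 1))) +
        finrank ℂ (LinearMap.ker (shift f z ^ (s + 1))) +
        (if z.im = 0 then 2 else 1) * Nat.card {i // eig i = z ∧ m i = s} := by
  simp only [finrank_ker_shift_pow_of_im_nonneg hb heig hz]
  rw [mul_left_comm, two_mul_sum_min _ _ hs]
  ring

end Multiplicity

/-! ### Quaternionic structures and operators conjugate to their inverses -/

/-- A finite-dimensional complex space with a quaternionic structure has even dimension. -/
theorem even_finrank_of_quaternionic_structure {U : Type*} [AddCommGroup U] [Module ℂ U]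
    [FiniteDimensional ℂ U] (J : U →ₛₗ[starRingEnd ℂ] U) (hJ : ∀ u, J (J u) = -u) :
    Even (finrank ℂ U) := by
  let b := finBasis ℂ U
  let M : Matrix (Fin (finrank ℂ U)) (Fin (finrank ℂ U)) ℂ :=
    Matrix.of fun i j => b.repr (J (b j)) i
  have hM : ∀ j, J (b j) = ∑ i, M i j • b i := fun j => (b.sum_repr _).symm
  -- This is `J² = -1` in coordinates, the conjugation coming from antilinearity. Determinants give
  -- `|det M|² = (-1)^d` with `d` the dimension, so `d` is even.
  have hMM : M * M.map (starRingEnd ℂ) = -1 := by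
    ext l j
    have h := hJ (b j)
    rw [hM, map_sum] at h
    have h' := congrArg (fun u => b.repr u l) h
    simp only [LinearMap.map_smulₛₗ, map_sum, map_smul, Finsupp.finsetSum_apply,
      Finsupp.smul_apply, smul_eq_mul, map_neg, Finsupp.neg_apply, Basis.repr_self] at h'
    rw [Matrix.mul_apply, Matrix.neg_apply, Matrix.one_apply]
    simp only [Matrix.map_apply]
    rw [Finset.sum_congr rfl fun i _ => mul_comm _ _]
    refine h'.trans ?_
    rw [Finsupp.single_apply]
    simp only [eq_comm]
  have hdet := congrArg Matrix.det hMM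
  rw [Matrix.det_mul, Matrix.det_neg, Matrix.det_one, mul_one, Fintype.card_fin] at hdet
  have hconj : (M.map (starRingEnd ℂ)).det = (starRingEnd ℂ) M.det :=
    ((starRingEnd ℂ).map_det M).symm
  rw [hconj, Complex.mul_conj] at hdet
  by_contra hodd
  rw [Nat.not_even_iff_odd] at hodd
  rw [hodd.neg_one_pow] at hdet
  have h1 : Complex.normSq M.det = -1 := by exact_mod_cast hdet
  have h2 := Complex.normSq_nonneg M.det
  linarith

section Reversing

variable {V : Type*} [AddCommGroup V] [Module (Quaternion ℝ) V] [Module ℂ V]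
  [IsScalarTower ℂ (Quaternion ℝ) V]

/-- Since `g = f⁻¹`, one has `g - z = -z g (f - z⁻¹)`, a product of commuting factors. -/
theorem shift_inverse_pow_eq_zero {f g : End (Quaternion ℝ) V} (hgf : g * f = 1) (hfg : f * g = 1)
    {z : ℂ} (hz : z ≠ 0) (k : ℕ) {x : V} (hx : (shift f z⁻¹ ^ k) x = 0) :
    (shift g z ^ k) x = 0 := by
  have h : shift g z = (-z) • ((g.restrictScalars ℂ : End ℂ V) * shift f z⁻¹) := by
    refine LinearMap.ext fun y => ?_
    rw [LinearMap.smul_apply, Module.End.mul_apply, shift_apply, shift_apply, map_sub, map_smul,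
      smul_sub, smul_smul, neg_mul, mul_inv_cancel₀ hz, LinearMap.coe_restrictScalars,
      ← Module.End.mul_apply, hgf, Module.End.one_apply, neg_smul, neg_smul, one_smul]
    abel
  have hc : Commute (g.restrictScalars ℂ : End ℂ V) (shift f z⁻¹) := by
    refine LinearMap.ext fun y => ?_
    simp only [Module.End.mul_apply, shift_apply, map_sub, LinearMap.coe_restrictScalars]
    rw [← Module.End.mul_apply g f, hgf, ← Module.End.mul_apply f g, hfg,
      ← LinearMap.coe_restrictScalars ℂ g, map_smul]
  rw [h, smul_pow, hc.mul_pow, LinearMap.smul_apply, Module.End.mul_apply, hx, map_zero, smul_zero]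

theorem map_shift_pow {f g h : End (Quaternion ℝ) V} (hfg : h * f = g * h) (z : ℂ) (k : ℕ) (x : V) :
    h ((shift f z ^ k) x) = (shift g z ^ k) (h x) := by
  induction k generalizing x with
  | zero => rfl
  | succ k ih =>
    rw [pow_succ, pow_succ, Module.End.mul_apply, Module.End.mul_apply, ih, shift_apply,
      shift_apply, map_sub, ← Module.End.mul_apply h f, hfg, Module.End.mul_apply,
      ← LinearMap.coe_restrictScalars ℂ h, map_smul]

theorem shift_pow_reversing_eq_zero {f g h : End (Quaternion ℝ) V} (hgf : g * f = 1)
    (hfg : f * g = 1) (hh : h * f = g * h) {z : ℂ} (hz : z ≠ 0) (k : ℕ) {x : V}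
    (hx : (shift f z ^ k) x = 0) : (shift f z⁻¹ ^ k) (h x) = 0 := by
  refine shift_inverse_pow_eq_zero hfg hgf (inv_ne_zero hz) k ?_
  rw [inv_inv, ← map_shift_pow hh, hx, map_zero]

theorem finrank_ker_shift_inv [FiniteDimensional ℂ V] {f g h : End (Quaternion ℝ) V}
    (hgf : g * f = 1) (hfg : f * g = 1) (hh : h * f = g * h) (hinj : Function.Injective h) {z : ℂ}
    (hz : z ≠ 0) (k : ℕ) :
    finrank ℂ (LinearMap.ker (shift f z ^ k)) = finrank ℂ (LinearMap.ker (shift f z⁻¹ ^ k)) := by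
  have key : ∀ z : ℂ, z ≠ 0 → finrank ℂ (LinearMap.ker (shift f z ^ k)) ≤
      finrank ℂ (LinearMap.ker (shift f z⁻¹ ^ k)) := fun z hz =>
    LinearMap.finrank_le_finrank_of_injective
      (f := (h.restrictScalars ℂ).restrict fun x hx =>
        LinearMap.mem_ker.2 (shift_pow_reversing_eq_zero hgf hfg hh hz k (LinearMap.mem_ker.1 hx)))
      fun x y hxy => Subtype.ext (hinj (congrArg Subtype.val hxy))
  exact le_antisymm (key z hz) (by have := key z⁻¹ (inv_ne_zero hz); rwa [inv_inv] at this)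

/-- On the unit circle inversion is conjugation, so `j` brings the image under `h` back into the
kernel, and `(j h)² = j² h² = -1`. -/
theorem even_finrank_ker_shift [FiniteDimensional ℂ V] {f g h : End (Quaternion ℝ) V}
    (hgf : g * f = 1) (hfg : f * g = 1) (hh : h * f = g * h) (hinv : h * h = 1) {z : ℂ}
    (hz : ‖z‖ = 1) (k : ℕ) : Even (finrank ℂ (LinearMap.ker (shift f z ^ k))) := by
  have hz0 : z ≠ 0 := by rintro rfl; simp at hz
  have hzc : (starRingEnd ℂ) z⁻¹ = z := by rw [Complex.inv_eq_conj hz, Complex.conj_conj]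
  have hmem : ∀ x ∈ LinearMap.ker (shift f z ^ k), unitJ • h x ∈ LinearMap.ker (shift f z ^ k) := by
    intro x hx
    have := unitJ_smul_shift_pow f z⁻¹ k (h x)
    rwa [shift_pow_reversing_eq_zero hgf hfg hh hz0 k hx, smul_zero, hzc, eq_comm] at this
  refine even_finrank_of_quaternionic_structure
    { toFun := fun x => ⟨unitJ • h x, hmem x x.2⟩
      map_add' := fun x y => Subtype.ext (by simp)
      map_smul' := fun c x => Subtype.ext (by
        change unitJ • (h.restrictScalars ℂ) (c • (x : V)) = _
        rw [map_smul, unitJ_smul_smul]; rfl) } fun x => Subtype.ext ?_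
  change unitJ • h (unitJ • h x) = -(x : V)
  rw [map_smul, unitJ_smul_unitJ_smul, ← Module.End.mul_apply, hinv, Module.End.one_apply]

variable {ι : Type*} [Fintype ι] {m : ι → ℕ}

theorem even_multiplicity [FiniteDimensional ℂ V] {f g h : End (Quaternion ℝ) V}
    (hgf : g * f = 1) (hfg : f * g = 1) (hh : h * f = g * h) (hinv : h * h = 1) {eig : ι → ℂ}
    {b : Basis (Σ i, Fin (m i)) (Quaternion ℝ) V} (hb : IsJordanBasis f eig b)
    (heig : ∀ i, 0 ≤ (eig i).im) (hm : ∀ i, 0 < m i) {z : ℂ} (hz0 : z.im ≠ 0) (hz : ‖z‖ = 1)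
    (s : ℕ) : Even (Nat.card {i // eig i = z ∧ m i = s}) := by
  by_cases hzs : 0 ≤ z.im ∧ 0 < s
  · have h := multiplicity_mul_eq hb heig hzs.1 hzs.2
    rw [if_neg hz0, one_mul] at h
    have h1 := even_finrank_ker_shift hgf hfg hh hinv hz (s - 1)
    have h2 := even_finrank_ker_shift hgf hfg hh hinv hz (s + 1)
    rw [← Nat.even_add.1 (h ▸ even_two_mul _)]
    exact h1.add h2
  · have : IsEmpty {i // eig i = z ∧ m i = s} :=
      ⟨fun i => hzs ⟨i.2.1 ▸ heig i, i.2.2 ▸ hm i⟩⟩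
    simp

/-- The map `h` links `conj z` to its inverse, and the kernel dimensions at `z` and `conj z` agree.
The composite symmetry preserves the closed upper half-plane, where the labels live. -/
theorem multiplicity_conj_inv [FiniteDimensional ℂ V] {f g h : End (Quaternion ℝ) V}
    (hgf : g * f = 1) (hfg : f * g = 1) (hh : h * f = g * h) (hinj : Function.Injective h)
    {eig : ι → ℂ} {b : Basis (Σ i, Fin (m i)) (Quaternion ℝ) V} (hb : IsJordanBasis f eig b)
    (heig : ∀ i, 0 ≤ (eig i).im) {z : ℂ} (hzi : 0 ≤ z.im) (hz : z ≠ 0)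
    {s : ℕ} (hs : 0 < s) : Nat.card {i // eig i = z ∧ m i = s} =
      Nat.card {i // eig i = ((starRingEnd ℂ) z)⁻¹ ∧ m i = s} := by
  have him : (((starRingEnd ℂ) z)⁻¹).im = z.im / Complex.normSq z := by
    rw [Complex.inv_im, Complex.conj_im, Complex.normSq_conj, neg_neg]
  have hn : 0 < Complex.normSq z := Complex.normSq_pos.2 hz
  have hd : ∀ k, finrank ℂ (LinearMap.ker (shift f z ^ k)) =
      finrank ℂ (LinearMap.ker (shift f ((starRingEnd ℂ) z)⁻¹ ^ k)) := by
    intro k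
    rw [← finrank_ker_shift_inv hgf hfg hh hinj ((map_ne_zero _).2 hz), finrank_ker_shift_pow hb,
      finrank_ker_shift_pow hb, add_comm]
    have hcs : ∀ w : ℂ, (starRingEnd ℂ) w = z ↔ w = (starRingEnd ℂ) z := fun w =>
      ⟨fun h => by rw [← h, Complex.conj_conj], fun h => by rw [h, Complex.conj_conj]⟩
    congr 1
    · exact Finset.sum_congr rfl fun i _ => if_congr (hcs _) rfl rfl
    · exact Finset.sum_congr rfl fun i _ => if_congr (starRingEnd ℂ).injective.eq_iff.symm rfl rfl
  have h1 := multiplicity_mul_eq hb heig hzi hs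
  have h2 := multiplicity_mul_eq hb heig (him ▸ div_nonneg hzi hn.le) hs
  have him0 : (((starRingEnd ℂ) z)⁻¹).im = 0 ↔ z.im = 0 := by
    rw [him, div_eq_zero_iff, or_iff_left hn.ne']
  rw [← hd, ← hd, ← hd, h1] at h2
  have h3 := Nat.add_left_cancel h2
  simp only [him0] at h3
  split_ifs at h3 <;> omega

end Reversing

/-! ### Pairing the blocks and building the involution -/

/-- Pairing off the elements of a finite set along an involution of their labels. -/
theorem exists_pairing {ι T : Type*} [DecidableEq ι] [DecidableEq T] (κ : ι → T) {τ : T → T}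
    (hτ : Function.Involutive τ) (B : Set T) (s : Finset ι)
    (hcard : ∀ t, (s.filter (κ · = t)).card = (s.filter (κ · = τ t)).card)
    (hB : ∀ t ∈ B, τ t = t → Even (s.filter (κ · = t)).card) :
    ∃ σ : ι → ι, ∀ i ∈ s, σ i ∈ s ∧ σ (σ i) = i ∧ κ (σ i) = τ (κ i) ∧ (σ i = i → κ i ∉ B) := by
  have herase : ∀ (s : Finset ι) (i : ι), i ∈ s → ∀ t, (s.filter (κ · = t)).card =
      ((s.erase i).filter (κ · = t)).card + if κ i = t then 1 else 0 := by
    intro s i hi t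
    rw [Finset.filter_erase]
    split_ifs with h
    · exact (Finset.card_erase_add_one (Finset.mem_filter.2 ⟨hi, h⟩)).symm
    · rw [Finset.erase_eq_of_notMem (a := i) fun h' => h (Finset.mem_filter.1 h').2, add_zero]
  have hτe : ∀ a t, τ a = t ↔ a = τ t := fun a t =>
    ⟨fun h => by rw [← h, hτ], fun h => by rw [h, hτ]⟩
  induction hn : s.card using Nat.strong_induction_on generalizing s with
  | _ n ih =>
    rcases s.eq_empty_or_nonempty with rfl | ⟨i, hi⟩
    · exact ⟨id, by simp⟩
    -- Only a `τ`-fixed label outside `B` lets `i` stay fixed. Otherwise a different partner exists: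
    -- in the class of `τ (κ i)` if this is another class, else because the class of `i` is even.
    by_cases hfix : τ (κ i) = κ i ∧ κ i ∉ B
    · obtain ⟨σ, hσ⟩ := ih _ (hn ▸ Finset.card_erase_lt_of_mem hi) (s.erase i)
        (fun t => by
          have h := hcard t
          rw [herase s i hi t, herase s i hi (τ t)] at h
          rw [if_congr (show κ i = τ t ↔ κ i = t by rw [← hτe, hfix.1]) rfl rfl] at h
          exact Nat.add_right_cancel h)
        (fun t ht htt => by
          have h := hB t ht htt
          rwa [herase s i hi t, if_neg (show κ i ≠ t from fun h' => hfix.2 (h'.symm ▸ ht)),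
            add_zero] at h) rfl
      refine ⟨fun l => if l = i then i else σ l, fun l hl => ?_⟩
      by_cases hli : l = i
      · subst hli
        simpa [hfix.1, hl] using hfix.2
      · obtain ⟨h1, h2, h3, h4⟩ := hσ l (Finset.mem_erase.2 ⟨hli, hl⟩)
        obtain ⟨h5, h6⟩ := Finset.mem_erase.1 h1
        simp only [hli, if_false, h5]
        exact ⟨h6, h2, h3, h4⟩
    · obtain ⟨i', hi', hii', hκ⟩ : ∃ i' ∈ s, i' ≠ i ∧ κ i' = τ (κ i) := by
        have hpos : 0 < (s.filter (κ · = κ i)).card :=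
          Finset.card_pos.2 ⟨i, Finset.mem_filter.2 ⟨hi, rfl⟩⟩
        by_cases h : τ (κ i) = κ i
        · have hb : κ i ∈ B := not_not.1 fun h' => hfix ⟨h, h'⟩
          have he := hB _ hb h
          obtain ⟨i', h1, h2⟩ := Finset.exists_mem_ne
            (show 1 < (s.filter (κ · = κ i)).card by
              obtain ⟨r, hr⟩ := he; omega) i
          rw [Finset.mem_filter] at h1
          exact ⟨i', h1.1, h2, h1.2.trans h.symm⟩
        · rw [hcard] at hpos
          obtain ⟨i', h1⟩ := Finset.card_pos.1 hpos
          rw [Finset.mem_filter] at h1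
          exact ⟨i', h1.1, fun h' => h (by rw [← h1.2, h']), h1.2⟩
      have hi'' : i' ∈ s.erase i := Finset.mem_erase.2 ⟨hii', hi'⟩
      have hκ' : κ i = τ (κ i') := by rw [hκ, hτ]
      have h2 : ∀ t, (s.filter (κ · = t)).card =
          (((s.erase i).erase i').filter (κ · = t)).card + (if κ i' = t then 1 else 0) +
            if κ i = t then 1 else 0 := fun t => by
        rw [herase s i hi t, herase _ i' hi'' t]
      obtain ⟨σ, hσ⟩ := ih _ (hn ▸ (Finset.card_erase_lt_of_mem hi'').trans
          (Finset.card_erase_lt_of_mem hi)) ((s.erase i).erase i')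
        (fun t => by
          have h := hcard t
          rw [h2 t, h2 (τ t), if_congr (show κ i' = τ t ↔ κ i = t by rw [← hτe, ← hκ']) rfl rfl,
            if_congr (show κ i = τ t ↔ κ i' = t by rw [← hτe, ← hκ]) rfl rfl] at h
          omega)
        (fun t ht htt => by
          have h := hB t ht htt
          rw [h2 t, if_congr (show κ i' = t ↔ κ i = t by rw [hκ, hτe, htt]) rfl rfl,
            add_assoc] at h
          exact (Nat.even_add.1 h).2 ⟨_, rfl⟩) rfl
      refine ⟨fun l => if l = i then i' else if l = i' then i else σ l, fun l hl => ?_⟩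
      by_cases hli : l = i
      · subst hli
        simp only [if_true, hii', if_false]
        exact ⟨hi', trivial, hκ, fun h => h.elim⟩
      by_cases hli' : l = i'
      · subst hli'
        simp only [if_true, hii', if_false]
        exact ⟨hi, trivial, hκ', fun h => (hii' h.symm).elim⟩
      · obtain ⟨h1, h2, h3, h4⟩ := hσ l
          (Finset.mem_erase.2 ⟨hli', Finset.mem_erase.2 ⟨hli, hl⟩⟩)
        obtain ⟨h5, h6⟩ := Finset.mem_erase.1 h1
        obtain ⟨h7, h8⟩ := Finset.mem_erase.1 h6
        simp only [hli, hli', if_false, h5, h7]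
        exact ⟨h8, h2, h3, h4⟩

section Construction

variable {V : Type*} [AddCommGroup V] [Module (Quaternion ℝ) V] [Module ℂ V]
  [IsScalarTower ℂ (Quaternion ℝ) V] {ι : Type*} {m : ι → ℕ}

theorem IsJordanBasis.shift_pow_apply {f : End (Quaternion ℝ) V} {eig : ι → ℂ}
    {b : Basis (Σ i, Fin (m i)) (Quaternion ℝ) V} (hb : IsJordanBasis f eig b)
    (i : ι) (hm : 0 < m i) (j : ℕ) :
    (shift f (eig i) ^ j) (b ⟨i, ⟨0, hm⟩⟩) = if h : j < m i then b ⟨i, ⟨j, h⟩⟩ else 0 := by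
  induction j with
  | zero => rw [dif_pos hm]; rfl
  | succ j ih =>
    rw [pow_succ', Module.End.mul_apply, ih]
    by_cases h : j < m i
    · rw [dif_pos h, shift_apply, hb i j h, complex_smul_eq, add_sub_cancel_left]
    · rw [dif_neg h, map_zero, dif_neg (by omega)]

/-- If the Jordan blocks can be paired off, the operator is reversed by an involution. -/
theorem exists_reversing_involution [LinearOrder ι] {f g : End (Quaternion ℝ) V}
    (hgf : g * f = 1) (hfg : f * g = 1) {eig : ι → ℂ}
    {b : Basis (Σ i, Fin (m i)) (Quaternion ℝ) V} (hb : IsJordanBasis f eig b)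
    (hm : ∀ i, 0 < m i) (heig : ∀ i, eig i ≠ 0) {σ : ι → ι} (hσ : Function.Involutive σ)
    (hσe : ∀ i, eig (σ i) = ((starRingEnd ℂ) (eig i))⁻¹) (hσm : ∀ i, m (σ i) = m i)
    (hσf : ∀ i, σ i = i → (eig i).im = 0) :
    ∃ h : End (Quaternion ℝ) V, h * h = 1 ∧ h * f = g * h := by
  let v : ι → V := fun i => b ⟨i, ⟨0, hm i⟩⟩
  -- Within a pair one head gets `j` and the other `-j`, so the product is 1. The order on `ι` only
  -- decides which gets which.
  let u : ι → Quaternion ℝ := fun i => if σ i = i then 1 else if i < σ i then unitJ else -unitJ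
  -- The values past the heads are forced: intertwining `f` with `g` turns powers of `f - λ` into
  -- powers of `g - λ`.
  let h : End (Quaternion ℝ) V :=
    b.constr ℕ fun x => (shift g (eig x.1) ^ (x.2 : ℕ)) (u x.1 • v (σ x.1))
  have hhb : ∀ i j (hj : j < m i),
      h (b ⟨i, ⟨j, hj⟩⟩) = (shift g (eig i) ^ j) (u i • v (σ i)) := fun i j hj => by
    simp only [h, Basis.constr_basis]
  have huu : ∀ i, u i * u (σ i) = 1 := by
    intro i
    simp only [u, hσ i]
    by_cases h1 : σ i = i
    · simp [h1]
    · have h1' : i ≠ σ i := fun h => h1 h.symm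
      simp only [h1, h1', if_false]
      rcases lt_or_gt_of_ne h1 with h2 | h2
      · rw [if_neg h2.not_gt, if_pos h2, neg_mul, unitJ_mul_unitJ, neg_neg]
      · rw [if_pos h2, if_neg h2.not_gt, mul_neg, unitJ_mul_unitJ, neg_neg]
  -- Consistency at the end of a chain, with λ = `eig i`: `v (σ i)` is killed by the power of `f -
  -- conj(λ)⁻¹`, hence of `g - conj(λ)`, and `j` turns this into `g - λ`. If `σ i = i`, λ is real
  -- and no `j` is needed.
  have hvan : ∀ i, (shift g (eig i) ^ m i) (u i • v (σ i)) = 0 := by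
    intro i
    have h1 : (shift f (eig (σ i)) ^ m i) (v (σ i)) = 0 := by
      rw [hb.shift_pow_apply, dif_neg (by rw [hσm]; exact lt_irrefl _)]
    rw [hσe] at h1
    have h2 := shift_inverse_pow_eq_zero hgf hfg ((map_ne_zero _).2 (heig i)) _ h1
    have h3 := unitJ_smul_shift_pow g ((starRingEnd ℂ) (eig i)) (m i) (v (σ i))
    rw [h2, smul_zero, Complex.conj_conj] at h3
    simp only [u]
    split_ifs with h4 h5
    · rwa [one_smul, ← Complex.conj_eq_iff_im.2 (hσf i h4)]
    · exact h3.symm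
    · rw [neg_smul, map_neg, ← h3, neg_zero]
  have hhf : h * f = g * h := by
    refine b.ext ?_
    rintro ⟨i, ⟨j, hj⟩⟩
    have h1 : h (if h : j + 1 < m i then b ⟨i, ⟨j + 1, h⟩⟩ else 0) =
        (shift g (eig i) ^ (j + 1)) (u i • v (σ i)) := by
      split_ifs with h2
      · exact hhb _ _ _
      · rw [map_zero, show j + 1 = m i by omega, hvan]
    rw [Module.End.mul_apply, Module.End.mul_apply, hb i j hj, map_add, map_smul, h1, hhb, pow_succ',
      Module.End.mul_apply, shift_apply, complex_smul_eq, add_sub_cancel]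
  refine ⟨h, ?_, hhf⟩
  have hhg : h * g = f * h := by
    calc h * g = f * g * (h * g) := by rw [hfg, one_mul]
      _ = f * (g * h) * g := by simp only [mul_assoc]
      _ = f * h * (f * g) := by rw [← hhf]; simp only [mul_assoc]
      _ = f * h := by rw [hfg, mul_one]
  -- As `h * h` commutes with `f`, it is the identity once it fixes the heads of the chains.
  have hcomm : h * h * f = f * (h * h) := by
    rw [mul_assoc, hhf, ← mul_assoc, hhg, mul_assoc]
  have hhv : ∀ i, h (v i) = u i • v (σ i) := fun i => hhb i 0 (hm i)
  refine b.ext ?_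
  rintro ⟨i, ⟨j, hj⟩⟩
  have hbj : b ⟨i, ⟨j, hj⟩⟩ = (shift f (eig i) ^ j) (v i) := by
    rw [hb.shift_pow_apply, dif_pos hj]
  rw [hbj, map_shift_pow hcomm, Module.End.mul_apply, hhv, map_smul, hhv, hσ i, smul_smul, huu,
    one_smul, Module.End.one_apply]

end Construction

/-! ### Matrices, Jordan decompositions and the determinant -/

section Matrices

variable {n : ℕ}

/-- The action of a quaternionic matrix on row vectors. -/
abbrev act (A : MatH n) : End (Quaternion ℝ) (Fin n → Quaternion ℝ) := Matrix.toLinearMapRight' A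

/-- Acting on rows leaves scalars on the left, at the price of reversing products. -/
theorem act_mul (A B : MatH n) : act (A * B) = act B * act A := Matrix.toLinearMapRight'_mul A B

theorem act_one : act (1 : MatH n) = 1 := Matrix.toLinearMapRight'_one

theorem act_injective : Function.Injective (act (n := n)) := Matrix.toLinearMapRight'.injective

theorem act_single (A : MatH n) (p : Fin n) : act A (Pi.single p 1) = A p :=
  (Matrix.toLinearMapRight'_apply _ _).trans (Matrix.single_one_vecMul _ _)

theorem act_row (A B : MatH n) (p : Fin n) : act A (B p) = (B * A) p := by
  rw [← act_single B, ← Module.End.mul_apply, ← act_mul, act_single]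

theorem act_inv_mul (a : GLH n) : act ((a⁻¹ : GLH n) : MatH n) * act (a : MatH n) = 1 := by
  rw [← act_mul, Units.mul_inv, act_one]

theorem act_mul_inv (a : GLH n) : act (a : MatH n) * act ((a⁻¹ : GLH n) : MatH n) = 1 := by
  rw [← act_mul, Units.inv_mul, act_one]

/-- Compensates for the order reversal of `act` when a reversing relation is transported. -/
theorem reversing_iff {R : Type*} [Monoid R] {f g h : R} (hgf : g * f = 1) (hfg : f * g = 1) :
    h * f = g * h ↔ f * h = h * g := by
  constructor <;> intro H
  · calc f * h = f * (h * f) * g := by rw [mul_assoc, mul_assoc, hfg, mul_one]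
      _ = h * g := by rw [H, ← mul_assoc, hfg, one_mul]
  · calc h * f = g * (f * h) * f := by rw [← mul_assoc, hgf, one_mul]
      _ = g * h := by rw [H, mul_assoc, mul_assoc, hgf, mul_one]

theorem act_reversing {a h : GLH n} (hh : h * a * h⁻¹ = a⁻¹) :
    act (h : MatH n) * act (a : MatH n) = act ((a⁻¹ : GLH n) : MatH n) * act (h : MatH n) := by
  rw [reversing_iff (act_inv_mul a) (act_mul_inv a), ← act_mul, ← act_mul, ← Units.val_mul,
    ← Units.val_mul, mul_inv_eq_iff_eq_mul.1 hh]

/-- The invertible matrix whose rows form a given basis. -/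
def rowsUnit (b : Basis (Fin n) (Quaternion ℝ) (Fin n → Quaternion ℝ)) : GLH n :=
  let L := (Pi.basisFun (Quaternion ℝ) (Fin n)).equiv b (Equiv.refl _)
  { val := LinearMap.toMatrixRight' L.toLinearMap
    inv := LinearMap.toMatrixRight' L.symm.toLinearMap
    val_inv := by
      rw [← LinearMap.toMatrixRight'_comp, LinearEquiv.symm_comp, LinearMap.toMatrixRight'_id]
    inv_val := by
      rw [← LinearMap.toMatrixRight'_comp, LinearEquiv.comp_symm, LinearMap.toMatrixRight'_id] }

theorem rowsUnit_apply (b : Basis (Fin n) (Quaternion ℝ) (Fin n → Quaternion ℝ)) (p : Fin n) :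
    (rowsUnit b : MatH n) p = b p := by
  rw [← act_single (rowsUnit b : MatH n) p]
  have h : act (rowsUnit b : MatH n) =
      ((Pi.basisFun (Quaternion ℝ) (Fin n)).equiv b (Equiv.refl _)).toLinearMap :=
    LinearEquiv.symm_apply_apply _ _
  rw [h, LinearEquiv.coe_coe, ← Pi.basisFun_apply, Basis.equiv_apply, Equiv.refl_apply]

/-- The rows of an invertible matrix form a basis. -/
def rowsBasis (S : GLH n) : Basis (Fin n) (Quaternion ℝ) (Fin n → Quaternion ℝ) :=
  (Pi.basisFun (Quaternion ℝ) (Fin n)).map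
    (LinearEquiv.ofLinearMap (act (S : MatH n)) (act ((S⁻¹ : GLH n) : MatH n)) (act_mul_inv S)
      (act_inv_mul S))

theorem rowsBasis_apply (S : GLH n) (p : Fin n) : rowsBasis S p = (S : MatH n) p := by
  rw [rowsBasis, Basis.map_apply, Pi.basisFun_apply]
  exact act_single _ _

theorem sum_jordanBlock_smul {V : Type*} [AddCommGroup V] [Module (Quaternion ℝ) V] (c : ℂ) {m : ℕ}
    (F : Fin m → V) (j : ℕ) (hj : j < m) :
    ∑ l, jordanBlock c m ⟨j, hj⟩ l • F l =
      (c : Quaternion ℝ) • F ⟨j, hj⟩ + if h : j + 1 < m then F ⟨j + 1, h⟩ else 0 := by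
  have h1 : ∀ l : Fin m, jordanBlock c m ⟨j, hj⟩ l • F l =
      (if (⟨j, hj⟩ : Fin m) = l then (c : Quaternion ℝ) • F l else 0) +
        if j + 1 = (l : ℕ) then F l else 0 := by
    intro l
    rw [jordanBlock, Matrix.of_apply]
    by_cases h : (⟨j, hj⟩ : Fin m) = l
    · rw [if_pos h, if_pos h, if_neg (by rw [← h]; simp), add_zero]
    · rw [if_neg h, if_neg h, zero_add, ite_smul, one_smul, zero_smul]
  rw [Finset.sum_congr rfl fun l _ => h1 l, Finset.sum_add_distrib, Finset.sum_ite_eq,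
    if_pos (Finset.mem_univ _)]
  congr 1
  split_ifs with h
  · rw [Finset.sum_eq_single ⟨j + 1, h⟩]
    · simp
    · intro l _ hl
      rw [if_neg fun h' => hl (Fin.ext h'.symm)]
    · simp
  · exact Finset.sum_eq_zero fun l _ => if_neg (by have := l.2; omega)

theorem sum_form_smul {V : Type*} [AddCommGroup V] [Module (Quaternion ℝ) V] (D : JordanData)
    (F : (Σ i, Fin (D.size i)) → V) (i : Fin D.k) (j : ℕ) (hj : j < D.size i) :
    ∑ y, D.form ⟨i, ⟨j, hj⟩⟩ y • F y = (D.eig i : Quaternion ℝ) • F ⟨i, ⟨j, hj⟩⟩ +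
      if h : j + 1 < D.size i then F ⟨i, ⟨j + 1, h⟩⟩ else 0 := by
  rw [Fintype.sum_sigma, Finset.sum_eq_single i]
  · rw [← sum_jordanBlock_smul (D.eig i) (fun l => F ⟨i, l⟩)]
    refine Finset.sum_congr rfl fun l _ => ?_
    rw [JordanData.form, Matrix.blockDiagonal'_apply_eq]
  · intro i' _ hi'
    refine Finset.sum_eq_zero fun l _ => ?_
    rw [JordanData.form, Matrix.blockDiagonal'_apply_ne _ _ _ hi'.symm, zero_smul]
  · simp

theorem row_mul_eq_sum (J S : MatH n) (p : Fin n) : (J * S) p = ∑ q, J p q • S q := by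
  funext l
  simp [Matrix.mul_apply, Finset.sum_apply]

theorem IsJordanDecomposition.exists_basis {A : MatH n} {D : JordanData}
    (hD : IsJordanDecomposition A D) :
    ∃ b : Basis (Σ i, Fin (D.size i)) (Quaternion ℝ) (Fin n → Quaternion ℝ),
      IsJordanBasis (act A) D.eig b := by
  obtain ⟨h, S, hS⟩ := hD
  let e := finSigmaFinEquiv.trans (finCongr h)
  refine ⟨(rowsBasis S).reindex e.symm, fun i j hj => ?_⟩
  -- Read row by row, `S A = J S` is the system of chain relations for the rows of `S`.
  have hSA : (S : MatH n) * A = Matrix.reindex e e D.form * S := by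
    rw [← hS, mul_assoc, Units.inv_mul, mul_one]
  have hb : ∀ x, (rowsBasis S).reindex e.symm x = (S : MatH n) (e x) := fun x => by
    rw [Basis.reindex_apply, rowsBasis_apply, Equiv.symm_symm]
  simp only [hb]
  rw [← sum_form_smul D fun x => (S : MatH n) (e x), act_row, hSA, row_mul_eq_sum, ← e.sum_comp]
  simp [Matrix.reindex_apply]

theorem isJordanDecomposition_of_basis {A : MatH n} {D : JordanData}
    (b : Basis (Σ i, Fin (D.size i)) (Quaternion ℝ) (Fin n → Quaternion ℝ))
    (hb : IsJordanBasis (act A) D.eig b) : IsJordanDecomposition A D := by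
  have h : ∑ i, D.size i = n := by
    have := finrank_eq_card_basis b
    rw [finrank_fin_fun, Fintype.card_sigma] at this
    simpa using this.symm
  let e := finSigmaFinEquiv.trans (finCongr h)
  let S := rowsUnit (b.reindex e)
  have hS : ∀ x, (S : MatH n) (e x) = b x := fun x => by
    rw [rowsUnit_apply, Basis.reindex_apply, Equiv.symm_apply_apply]
  have hSA : (S : MatH n) * A = Matrix.reindex e e D.form * S := by
    funext p
    obtain ⟨⟨i, ⟨j, hj⟩⟩, rfl⟩ := e.surjective p
    rw [← act_row, hS, hb i j hj, ← sum_form_smul D b, row_mul_eq_sum, ← e.sum_comp]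
    simp [Matrix.reindex_apply, hS]
  refine ⟨h, S, ?_⟩
  rw [hSA, mul_assoc, Units.mul_inv, mul_one]

/-- Every quaternionic matrix has a Jordan decomposition. -/
theorem exists_isJordanDecomposition (A : MatH n) : ∃ D, IsJordanDecomposition A D := by
  obtain ⟨ι, _, c, m, b, hc, hm, hb, hz, hi, hs⟩ := hasJordanBasis_quaternion _ (act A)
  choose z hz0 hcz using hc
  let E := Fintype.equivFin ι
  let D : JordanData :=
    { k := Fintype.card ι
      eig := fun i => z (E.symm i)
      size := fun i => m (E.symm i)
      eig_im_nonneg := fun i => hz0 _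
      size_pos := fun i => hm _ }
  let B : Basis (Σ i, Fin (m i)) (Quaternion ℝ) (Fin n → Quaternion ℝ) := Basis.mk hi hs.ge
  let e : (Σ i, Fin (D.size i)) ≃ Σ i, Fin (m i) := E.symm.sigmaCongrLeft (β := fun i => Fin (m i))
  refine ⟨D, isJordanDecomposition_of_basis (B.reindex e.symm) fun i j hj => ?_⟩
  have hB : ∀ i j (hj : j < D.size i), B.reindex e.symm ⟨i, ⟨j, hj⟩⟩ = b (E.symm i) j :=
    fun i j hj => by rw [Basis.reindex_apply, Basis.mk_apply]; rfl
  rw [hB, hb, hcz]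
  congr 1
  split_ifs with h
  · rw [hB]
  · rw [show j + 1 = m (E.symm i) from le_antisymm hj (not_lt.1 h), hz]

/-- For a complex matrix the associated complex matrix is block diagonal, with two conjugate blocks.
-/
theorem qdet_of_jpart_eq_zero {X : MatH n} (hX : ∀ p q, jpart (X p q) = 0) :
    qdet X = Complex.normSq (X.map cpart).det := by
  have h1 : X.map jpart = 0 := by ext p q; exact hX p q
  have h2 : (X.map fun q => (starRingEnd ℂ) (jpart q)) = 0 := by
    ext p q; simp [hX p q]
  have h3 : (X.map fun q => (starRingEnd ℂ) (cpart q)) = (X.map cpart).map (starRingEnd ℂ) := by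
    rw [Matrix.map_map]; rfl
  rw [qdet, toComplex, h1, h2, h3, neg_zero, Matrix.det_fromBlocks_zero₂₁, ← Complex.mul_conj]
  congr 1
  exact ((starRingEnd ℂ).map_det _).symm

theorem JordanData.jpart_form (D : JordanData) (x y) : jpart (D.form x y) = 0 := by
  obtain ⟨i, j⟩ := x
  obtain ⟨i', j'⟩ := y
  rcases eq_or_ne i i' with rfl | h
  · rw [JordanData.form, Matrix.blockDiagonal'_apply_eq, jordanBlock, Matrix.of_apply]
    split_ifs <;> rfl
  · rw [JordanData.form, Matrix.blockDiagonal'_apply_ne _ _ _ h]; rfl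

/-- The quaternionic determinant is real and non-negative. -/
theorem exists_qdet_eq (A : MatH n) : ∃ r : ℝ, 0 ≤ r ∧ qdet A = r := by
  obtain ⟨D, h, S, hS⟩ := exists_isJordanDecomposition A
  have hq := congrArg qdet hS
  rw [qdet_mul, qdet_mul, mul_right_comm, ← qdet_mul, Units.mul_inv, qdet_one, one_mul,
    qdet_of_jpart_eq_zero (X := Matrix.reindex _ _ D.form) fun p q => D.jpart_form _ _] at hq
  exact ⟨_, Complex.normSq_nonneg _, hq⟩

theorem qdet_eq_one_of_mul_self {A : MatH n} (hA : A * A = 1) : qdet A = 1 := by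
  obtain ⟨r, hr, h⟩ := exists_qdet_eq A
  have h1 := congrArg qdet hA
  rw [qdet_mul, qdet_one, h] at h1
  have h2 : r * r = 1 := by exact_mod_cast h1
  rw [h, show r = 1 by nlinarith, Complex.ofReal_one]

/-! ### Strong reversibility and even multiplicities -/

theorem stronglyReversible_SLH_iff (A : SLH n) :
    StronglyReversible A ↔ StronglyReversible (A : GLH n) := by
  constructor
  · rintro ⟨h, h1, h2⟩
    exact ⟨h, congrArg Subtype.val h1, congrArg Subtype.val h2⟩
  · rintro ⟨h, h1, h2⟩
    exact ⟨⟨h, qdet_eq_one_of_mul_self (congrArg Units.val h1)⟩, Subtype.ext h1, Subtype.ext h2⟩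

theorem StronglyReversible.evenNonrealUnit {a : GLH n} (ha : StronglyReversible a) {D : JordanData}
    (hD : IsJordanDecomposition (a : MatH n) D) : D.EvenNonrealUnit := by
  obtain ⟨h, h1, h2⟩ := ha
  obtain ⟨b, hb⟩ := hD.exists_basis
  have : FiniteDimensional ℂ (Fin n → Quaternion ℝ) := Module.Finite.trans (Quaternion ℝ) _
  intro c hc0 hc s
  refine even_multiplicity (act_inv_mul a) (act_mul_inv a) (act_reversing h2) ?_ hb D.eig_im_nonneg
    D.size_pos hc0 hc s
  rw [← act_mul, ← Units.val_mul, h1, Units.val_one, act_one]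

theorem IsJordanBasis.eig_ne_zero {V : Type*} [AddCommGroup V] [Module (Quaternion ℝ) V]
    {ι : Type*} {m : ι → ℕ} {f g : End (Quaternion ℝ) V} (hgf : g * f = 1) {eig : ι → ℂ}
    {b : Basis (Σ i, Fin (m i)) (Quaternion ℝ) V} (hb : IsJordanBasis f eig b)
    (hm : ∀ i, 0 < m i) (i : ι) : eig i ≠ 0 := by
  intro h0
  have hlt : m i - 1 < m i := Nat.sub_lt (hm i) one_pos
  have h := hb i (m i - 1) hlt
  rw [h0, Quaternion.coeComplex_zero, zero_smul, dif_neg (by have := hm i; omega), add_zero] at h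
  refine b.ne_zero ⟨i, ⟨m i - 1, hlt⟩⟩ ?_
  rw [← Module.End.one_apply (R := Quaternion ℝ) (b _), ← hgf, Module.End.mul_apply, h, map_zero]

theorem Reversible.multiplicity_conj_inv {a : GLH n} (ha : Reversible a) {D : JordanData}
    (hD : IsJordanDecomposition (a : MatH n) D) (z : ℂ) (s : ℕ) :
    D.multiplicity z s = D.multiplicity ((starRingEnd ℂ) z)⁻¹ s := by
  obtain ⟨h, hh⟩ := ha
  obtain ⟨b, hb⟩ := hD.exists_basis
  have : FiniteDimensional ℂ (Fin n → Quaternion ℝ) := Module.Finite.trans (Quaternion ℝ) _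
  rcases eq_or_ne z 0 with rfl | hz
  -- Here `0⁻¹ = 0`, so both labels coincide.
  · simp
  by_cases hzs : 0 ≤ z.im ∧ 0 < s
  · refine QuatRev.multiplicity_conj_inv (act_inv_mul a) (act_mul_inv a) (act_reversing hh)
      (Function.LeftInverse.injective (g := act ((h⁻¹ : GLH n) : MatH n)) fun x => ?_) hb
      D.eig_im_nonneg hzs.1 hz hzs.2
    rw [← Module.End.mul_apply, act_inv_mul, Module.End.one_apply]
  · have hn : 0 < Complex.normSq z := Complex.normSq_pos.2 hz
    have h1 : IsEmpty {i // D.eig i = z ∧ D.size i = s} :=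
      ⟨fun i => hzs ⟨i.2.1 ▸ D.eig_im_nonneg i, i.2.2 ▸ D.size_pos i⟩⟩
    have h2 : IsEmpty {i // D.eig i = ((starRingEnd ℂ) z)⁻¹ ∧ D.size i = s} := by
      refine ⟨fun i => hzs ⟨?_, i.2.2 ▸ D.size_pos i⟩⟩
      have h3 := D.eig_im_nonneg i
      rw [i.2.1, Complex.inv_im, Complex.conj_im, Complex.normSq_conj, neg_neg] at h3
      rwa [le_div_iff₀ hn, zero_mul] at h3
    rw [JordanData.multiplicity, JordanData.multiplicity, Nat.card_of_isEmpty, Nat.card_of_isEmpty]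

theorem norm_eq_one_of_conj_inv_eq {z : ℂ} (hz : z ≠ 0) (h : ((starRingEnd ℂ) z)⁻¹ = z) :
    ‖z‖ = 1 := by
  have h1 := congrArg norm h
  rw [norm_inv, Complex.norm_conj] at h1
  have h2 : ‖z‖ ≠ 0 := norm_ne_zero_iff.2 hz
  have h3 : ‖z‖ * ‖z‖ = 1 := by
    nth_rewrite 1 [← h1]
    exact inv_mul_cancel₀ h2
  nlinarith [norm_nonneg z]

theorem Reversible.stronglyReversible {a : GLH n} (ha : Reversible a) {D : JordanData}
    (hD : IsJordanDecomposition (a : MatH n) D) (hE : D.EvenNonrealUnit) :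
    StronglyReversible a := by
  classical
  obtain ⟨b, hb⟩ := hD.exists_basis
  have hne := hb.eig_ne_zero (act_inv_mul a) D.size_pos
  let κ : Fin D.k → ℂ × ℕ := fun i => (D.eig i, D.size i)
  let τ : ℂ × ℕ → ℂ × ℕ := fun t => (((starRingEnd ℂ) t.1)⁻¹, t.2)
  have hτ : Function.Involutive τ := fun t => by simp [τ]
  have hcount : ∀ t, (Finset.univ.filter (κ · = t)).card = D.multiplicity t.1 t.2 := by
    rintro ⟨z, s⟩
    rw [JordanData.multiplicity, Nat.card_eq_fintype_card, Fintype.card_subtype]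
    simp [κ, Prod.ext_iff]
  -- A nonreal eigenvalue equal to its conjugate inverse has modulus 1, so the evenness assumption
  -- covers exactly the labels where fixed points must be avoided.
  obtain ⟨σ, hσ⟩ := exists_pairing κ hτ {t | t.1.im ≠ 0} Finset.univ
    (fun t => by rw [hcount, hcount]; exact ha.multiplicity_conj_inv hD t.1 t.2)
    (fun t ht htt => by
      rw [hcount]
      have ht' : t.1.im ≠ 0 := ht
      exact hE t.1 ht' (norm_eq_one_of_conj_inv_eq (fun h => ht' (by simp [h]))
        (congrArg Prod.fst htt)) t.2)
  obtain ⟨H, hH, hHf⟩ := exists_reversing_involution (act_inv_mul a) (act_mul_inv a) hb D.size_pos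
    hne (σ := σ) (fun i => (hσ i (Finset.mem_univ i)).2.1)
    (fun i => congrArg Prod.fst (hσ i (Finset.mem_univ i)).2.2.1)
    (fun i => congrArg Prod.snd (hσ i (Finset.mem_univ i)).2.2.1)
    (fun i hi => not_not.1 ((hσ i (Finset.mem_univ i)).2.2.2 hi))
  obtain ⟨X, rfl⟩ := Matrix.toLinearMapRight'.surjective H
  have hX : X * X = 1 := act_injective (by rw [act_mul, hH, act_one])
  rw [reversing_iff (act_inv_mul a) (act_mul_inv a)] at hHf
  refine ⟨⟨X, X, hX, hX⟩, Units.ext hX, mul_inv_eq_iff_eq_mul.2 (Units.ext (act_injective ?_))⟩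
  rw [Units.val_mul, Units.val_mul, act_mul, act_mul]
  exact hHf

end Matrices

end QuatRev

end

theorem theorem1p3 (n : ℕ) (A : QuatRev.SLH n) (hA : QuatRev.Reversible A) :
    (∃ D : QuatRev.JordanData,
      QuatRev.IsJordanDecomposition ((A : QuatRev.GLH n) : QuatRev.MatH n) D) ∧
    ∀ D : QuatRev.JordanData,
      QuatRev.IsJordanDecomposition ((A : QuatRev.GLH n) : QuatRev.MatH n) D →
      (QuatRev.StronglyReversible A ↔ D.EvenNonrealUnit) ∧
      (QuatRev.StronglyReversible (A : QuatRev.GLH n) ↔ D.EvenNonrealUnit) := by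
  refine ⟨QuatRev.exists_isJordanDecomposition _, fun D hD => ?_⟩
  have hA' : QuatRev.Reversible (A : QuatRev.GLH n) := by
    obtain ⟨h, hh⟩ := hA
    exact ⟨h, congrArg Subtype.val hh⟩
  have key : QuatRev.StronglyReversible (A : QuatRev.GLH n) ↔ D.EvenNonrealUnit :=
    ⟨fun h => h.evenNonrealUnit hD, fun h => hA'.stronglyReversible hD h⟩
  exact ⟨(QuatRev.stronglyReversible_SLH_iff A).trans key, key⟩
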